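/- **Setting.** A $k$-local Hamiltonian on finitely many qudits is a sum $\sum_S h_S$ of Hermitian terms, indexed by distinct sets $S$ of at most $k$ qudits, where $h_S$ acts only on the qudits in $S$. The degree of a qudit is the number of terms whose set contains it. $\|\cdot\|$ is the spectral norm. For $n\ge 2$ let $$H_A=\sum_{1\le i<j\le n}|1\rangle\langle 1|^{(i)}\otimes|1\rangle\langle 1|^{(j)}$$ on $n$ qubits; it has $M_0(n)=n(n-1)/2$ terms. Let $P$ be the projector onto its groundspace and $\gamma$ its spectral gap. A Hamiltonian $\tilde H$ on $\tilde{\mathcal H}$ *gap-simulates* $H_A$ with encoding $V:\mathcal H\otimes\mathcal H_{\rm anc}\to\tilde{\mathcal H}$ (an isometry), incoherence $\epsilon$ and energy spread $\tilde w\in[0,1)$ if there are Hermitian projectors $\tilde P$ on $\tilde{\mathcal H}$ and $P_{\rm anc}$ on $\mathcal H_{\rm anc}$ such that, with $\tilde E$ the lowest eigenvalue of $\tilde H$ and $\tilde P^\perp=1-\tilde P$: $[\tilde H,\tilde P]=0$; $\|\tilde P(\tilde H-\tilde E)\tilde P\|\le\tilde w\gamma$; all eigenvalues of $\tilde P^\perp(\tilde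 H-\tilde E)\tilde P^\perp+\gamma\tilde P$ are at least $\gamma$; and $\|\tilde P-V(P\otimes P_{\rm anc})V^\dagger\|\le\epsilon$. The encoding is trivial if $\tilde{\mathcal H}=\mathcal H\otimes\mathcal H_{\rm anc}$, with $\mathcal H_{\rm anc}$ the space of additional qudits, and $V=1$. A family of $k$-local gap-simulators (indexed by $n$, on qudits of bounded dimension) with maximum degree at most $r$, $M$ terms and terms of norm at most $J$ is a $k$-local $[r,M,J]$-*degree-reducer* of $H_A$ if $r=O(1)$, and an $[r,M,J]$-*diluter* of $H_A$ if $M=o(M_0(n))$ as $n\to\infty$. **Tree counting circuit.** It acts on $n$ qubits and $n-1$ ancilla qutrits, located at the nodes $1,\dots,2n-1$ of the binary tree in which an internal node $v\in\{1,\dots,n-1\}$ has the children $2v$ and $2v+1$: the qutrits are at the internal nodes and the original qubits at the leaves $n,\dots,2n-1$. For $1\le t\le n-1$ the gate $U_t$ acts on the node $v=n-t$ and its children: if $l,r$ are the basis states of the children and $z$ is that of node $v$, then for $t\le n-2$ it maps $z$ to $z$ if $lr=00$, to $z+1 \bmod 3$ if $lr\in\{10,01\}$, and to $2-z$ otherwise;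 at the root ($t=n-1$) it maps $z$ to $z$ if $lr\in\{00,10,01\}$ and to $z+1\bmod 3$ otherwise. The *uncomputed tree counting circuit with $L$ idle gates* is the sequence $U_1,\dots,U_{n-2},U_{n-1},U_{n-2}^\dagger,\dots,U_1^\dagger$ followed by $L$ identity gates, of total length $T=2n-3+L$; write again $U_1,\dots,U_T$ for this sequence. Adjoin clock qubits $1,\dots,T$ and, in the clock projectors and transitions below, put formally the clock bits $1$ at position $0$ and $0$ at position $T+1$. The *circuit Hamiltonian* with weights $J_{\rm clock},J_{\rm prop},J_{\rm in},J_{\rm out}>0$ is $$J_{\rm clock}\sum_{t=1}^{T-1}|01\rangle\langle01|_{t,t+1}+J_{\rm prop}\sum_{t=1}^{T}\Big(|100\rangle\langle100|+|110\rangle\langle110|-U_t\otimes|110\rangle\langle100|-U_t^\dagger\otimes|100\rangle\langle110|\Big)_{t-1,t,t+1}$$ $$+J_{\rm in}\sum_{v=1}^{n-1}(1-|0\rangle\langle0|)_v\otimes|0\rangle\langle0|^{\rm clock}_{n-v}+J_{\rm out}(1-|0\rangle\langle0|)_{\rm root}\otimes|1\rangle\langle1|^{\rm clock}_{n-1}.$$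 **Proposition.** There are constants $C$ and $c$ such that for every $\epsilon\in(0,1]$ there is a family $(\tilde H_n)_{n\ge 2}$ of Hamiltonians, each of them acting on $n$ original qubits together with additional qubits and qutrits, and functions $M(n)\le Cn/\epsilon^2$ and $J(n)\le C(n/\epsilon)^c$, such that $\tilde H$ is a 6-local $[6,M,J]$-degree-reducer of $H_A$ with incoherence $\epsilon$, energy spread $0$ and trivial encoding, and is also a 6-local $[6,M,J]$-diluter of $H_A$ (for the fixed $\epsilon$, as $n\to\infty$) with the same incoherence, energy spread and encoding. Moreover, $\tilde H_n$ can be taken to be the circuit Hamiltonian of the uncomputed tree counting circuit with $L(n)\le Cn/\epsilon^2$ idle gates, for suitable positive weights $J_{\rm clock},J_{\rm prop},J_{\rm in},J_{\rm out}$ depending on $n$ and $\epsilon$. -/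

import Mathlib

open scoped Matrix Kronecker Matrix.Norms.L2Operator

namespace GapSim

/-! ### Local Hamiltonians on finitely many qudits -/

section LocalHamiltonians

/-- Computational basis labels of a system of qudits: site `i` has internal states `0, …, d i - 1`. -/
abbrev Config {ι : Type} (d : ι → ℕ) : Type := (i : ι) → Fin (d i)

/-- Operators on the Hilbert space `⨂ i, ℂ^(d i)`, as matrices in the computational basis.
The norm `‖A‖` of an operator is the spectral norm. -/
abbrev Op {ι : Type} (d : ι → ℕ) : Type := Matrix (Config d) (Config d) ℂ

variable {ι : Type} [Fintype ι] [DecidableEq ι] {d : ι → ℕ}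

/-- `A = B ⊗ 1`, with `B` acting on the qudits in `S` and `1` on all other qudits. -/
def ActsOn (A : Op d) (S : Finset ι) : Prop :=
  ∃ B : Matrix ((i : S) → Fin (d i)) ((i : S) → Fin (d i)) ℂ, ∀ x y : Config d,
    A x y = if ∀ i, i ∉ S → x i = y i then B (fun i => x i) (fun i => y i) else 0

variable (d) in
/-- A Hamiltonian presented as a sum of Hermitian terms, one for every hyperedge of its
interaction hypergraph; the term of a hyperedge `S` acts on the qudits in `S` only. -/
structure LocalHamiltonian where
  edges : Finset (Finset ι)
  term : Finset ι → Op d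
  hermitian : ∀ S ∈ edges, (term S).IsHermitian
  actsOn : ∀ S ∈ edges, ActsOn (term S) S

namespace LocalHamiltonian

/-- The Hamiltonian itself: the sum of its terms. -/
def total (H : LocalHamiltonian d) : Op d := ∑ S ∈ H.edges, H.term S

/-- Every term acts on at most `k` qudits. -/
def IsLocal (H : LocalHamiltonian d) (k : ℕ) : Prop := ∀ S ∈ H.edges, S.card ≤ k

/-- The number of terms. -/
def numTerms (H : LocalHamiltonian d) : ℕ := H.edges.card

/-- The degree of the qudit `i`: the number of terms in which it takes part. -/
def degree (H : LocalHamiltonian d) (i : ι) : ℕ := (H.edges.filter (fun S => i ∈ S)).card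

end LocalHamiltonian

end LocalHamiltonians

/-! ### Gap-simulation -/

section GapSimulation

variable {m m' a : Type} [Fintype m] [DecidableEq m] [Fintype m'] [DecidableEq m']
  [Fintype a] [DecidableEq a]

/-- Hermitian projectors. -/
def IsProjector (P : Matrix m m ℂ) : Prop := P.IsHermitian ∧ P * P = P

/-- `P` projects onto a quasi-groundspace of the Hamiltonian `H`, with energy spread `w` and
quasi-spectral gap (at least) `γ`. Here `E` is the lowest eigenvalue of `H`. -/
structure IsQuasiGroundspace (H P : Matrix m m ℂ) (w γ : ℝ) : Prop where
  hermitian : H.IsHermitian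
  projector : IsProjector P
  gap_pos : 0 < γ
  spread_nonneg : 0 ≤ w
  spread_lt_one : w < 1
  commute : H * P = P * H
  energy : ∃ E : ℝ, IsLeast (spectrum ℝ H) E ∧
    ‖P * (H - (E : ℂ) • 1) * P‖ ≤ w * γ ∧
    ∀ μ ∈ spectrum ℝ ((1 - P) * (H - (E : ℂ) • 1) * (1 - P) + (γ : ℂ) • P), γ ≤ μ

/-- `P` projects onto the groundspace of `H`, and `γ` is the spectral gap of `H`: the distance
between its lowest eigenvalue and its other eigenvalues. -/
def IsGroundspace (H P : Matrix m m ℂ) (γ : ℝ) : Prop :=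
  IsQuasiGroundspace H P 0 γ ∧
    ∃ E : ℝ, IsLeast (spectrum ℝ H) E ∧
      IsLeast {δ : ℝ | ∃ μ ∈ spectrum ℝ H, μ ≠ E ∧ δ = μ - E} γ

/-- `H'` gap-simulates `(H, P)`, where `P` has quasi-spectral gap `γ`, with encoding `V`,
incoherence `ε` and energy spread `w`. -/
def GapSimulatesPair (H P : Matrix m m ℂ) (γ : ℝ) (H' : Matrix m' m' ℂ)
    (V : Matrix m' (m × a) ℂ) (ε w : ℝ) : Prop :=
  Vᴴ * V = 1 ∧ (∃ w₀ : ℝ, IsQuasiGroundspace H P w₀ γ) ∧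
  ∃ P' : Matrix m' m' ℂ, IsQuasiGroundspace H' P' w γ ∧
    ∃ Panc : Matrix a a ℂ, IsProjector Panc ∧ ‖P' - V * (P ⊗ₖ Panc) * Vᴴ‖ ≤ ε

/-- `H'` gap-simulates `H` (that is, its groundspace) with encoding `V`, incoherence `ε` and
energy spread `w`. -/
def GapSimulates (H : Matrix m m ℂ) (H' : Matrix m' m' ℂ)
    (V : Matrix m' (m × a) ℂ) (ε w : ℝ) : Prop :=
  ∃ (P : Matrix m m ℂ) (γ : ℝ), IsGroundspace H P γ ∧ GapSimulatesPair H P γ H' V ε w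

end GapSimulation

/-- The trivial encoding `V = 1`: the simulator acts on the original qudits together with
ancilla qudits, and `V` identifies `|x⟩ ⊗ |y⟩` with the corresponding basis state of all qudits. -/
def trivialEncoding {ι κ : Type} [Fintype ι] [Fintype κ] (d : ι → ℕ) (e : κ → ℕ) :
    Matrix (Config (Sum.elim d e)) (Config d × Config e) ℂ :=
  fun z p => if (∀ i, (z (Sum.inl i)).val = (p.1 i).val) ∧ (∀ j, (z (Sum.inr j)).val = (p.2 j).val)
    then 1 else 0

/-! ### Degree-reducers and diluters of families of Hamiltonians -/

section Sparsifiers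

variable {ι ι' a : ℕ → Type} [∀ n, Fintype (ι n)] [∀ n, DecidableEq (ι n)]
  [∀ n, Fintype (ι' n)] [∀ n, DecidableEq (ι' n)] [∀ n, Fintype (a n)] [∀ n, DecidableEq (a n)]
  {d : ∀ n, ι n → ℕ} {d' : ∀ n, ι' n → ℕ}

/-- For every `n ≥ n₀`, `H' n` is a `k`-local `[r, M, J]`-gap-simulator of `H n` with encoding
`V n`, incoherence `ε` and energy spread `w`: its maximum degree is at most `r n`, it has `M n`
terms, and these have norm at most `J n`. The terms of `H` are `O(1)`-local, and the local
dimensions of all qudits are `O(1)`. -/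
structure IsGapSimulator (n₀ : ℕ) (H : ∀ n, LocalHamiltonian (d n))
    (H' : ∀ n, LocalHamiltonian (d' n)) (V : ∀ n, Matrix (Config (d' n)) (Config (d n) × a n) ℂ)
    (k : ℕ) (r M : ℕ → ℕ) (J : ℕ → ℝ) (ε w : ℝ) : Prop where
  source_local : ∃ k₀ : ℕ, ∀ n, n₀ ≤ n → (H n).IsLocal k₀
  dim_bounded : ∃ D : ℕ, ∀ n, n₀ ≤ n → (∀ i, d n i ≤ D) ∧ ∀ i, d' n i ≤ D
  simulates : ∀ n, n₀ ≤ n → GapSimulates (H n).total (H' n).total (V n) ε w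
  isLocal : ∀ n, n₀ ≤ n → (H' n).IsLocal k
  degree_le : ∀ n, n₀ ≤ n → ∀ i, (H' n).degree i ≤ r n
  numTerms_eq : ∀ n, n₀ ≤ n → (H' n).numTerms = M n
  strength_le : ∀ n, n₀ ≤ n → ∀ S ∈ (H' n).edges, ‖(H' n).term S‖ ≤ J n

/-- Degree-reducers: gap-simulators with `r = O(1)`. -/
def IsDegreeReducer (n₀ : ℕ) (H : ∀ n, LocalHamiltonian (d n))
    (H' : ∀ n, LocalHamiltonian (d' n)) (V : ∀ n, Matrix (Config (d' n)) (Config (d n) × a n) ℂ)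
    (k : ℕ) (r M : ℕ → ℕ) (J : ℕ → ℝ) (ε w : ℝ) : Prop :=
  IsGapSimulator n₀ H H' V k r M J ε w ∧
    (fun n => (r n : ℝ)) =O[Filter.atTop] (fun _ => (1 : ℝ))

/-- Diluters: gap-simulators with `M = o(M₀)`, where `M₀ n` is the number of terms of `H n`. -/
def IsDiluter (n₀ : ℕ) (H : ∀ n, LocalHamiltonian (d n))
    (H' : ∀ n, LocalHamiltonian (d' n)) (V : ∀ n, Matrix (Config (d' n)) (Config (d n) × a n) ℂ)
    (k : ℕ) (r M : ℕ → ℕ) (J : ℕ → ℝ) (ε w : ℝ) : Prop :=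
  IsGapSimulator n₀ H H' V k r M J ε w ∧
    (fun n => (M n : ℝ)) =o[Filter.atTop] (fun n => ((H n).numTerms : ℝ))

end Sparsifiers

/-! ### The Hamiltonian `H_A` -/

/-- The local dimensions of `n` qubits. -/
abbrev qubitDim (n : ℕ) : Fin n → ℕ := fun _ => 2

/-- `H_A = ∑ i < j, |1⟩⟨1|_i ⊗ |1⟩⟨1|_j` on `n` qubits, with one term for each pair of qubits. -/
def HA (n : ℕ) : LocalHamiltonian (qubitDim n) where
  edges := Finset.powersetCard 2 Finset.univ
  term S := Matrix.diagonal (fun x => if ∀ i ∈ S, x i = 1 then 1 else 0)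
  hermitian S _ := by
    rw [Matrix.IsHermitian, Matrix.diagonal_conjTranspose]
    congr 1
    funext x
    simp only [Pi.star_apply]
    split_ifs <;> simp
  actsOn S _ := by
    refine ⟨Matrix.diagonal (fun u => if ∀ i, u i = 1 then 1 else 0), fun x y => ?_⟩
    simp only [Matrix.diagonal_apply]
    by_cases hxy : x = y
    · subst hxy
      simp
    · rw [if_neg hxy]
      split_ifs with h1 h2 h3
      · exfalso
        apply hxy
        funext i
        by_cases hi : i ∈ S
        · exact congrFun h2 ⟨i, hi⟩
        · exact h1 i hi
      all_goals rfl

/-! ### The circuit Hamiltonian of the uncomputed tree counting circuit -/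

section TreeCircuit

/-- Local dimensions of the additional qudits: `n - 1` ancilla qutrits and `T` clock qubits. -/
abbrev workDim (n T : ℕ) : Fin (n - 1) ⊕ Fin T → ℕ := Sum.elim (fun _ => 3) (fun _ => 2)

/-- Local dimensions of all qudits: `n` original qubits, `n - 1` ancilla qutrits, `T` clock
qubits. -/
abbrev siteDim (n T : ℕ) : Fin n ⊕ (Fin (n - 1) ⊕ Fin T) → ℕ :=
  Sum.elim (qubitDim n) (workDim n T)

variable {n T : ℕ}

/-- The state of the `v`-th node of the binary tree. The nodes are numbered `1, …, 2n - 1`; node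
`v < n` is internal, with children `2v` and `2v + 1`, and carries the ancilla qutrit with index
`v - 1`; node `v ≥ n` is a leaf and carries the original qubit with index `v - n`. -/
def nodeState (x : Config (siteDim n T)) (v : ℕ) : ℕ :=
  if h : 1 ≤ v ∧ v < n then (x (Sum.inr (Sum.inl ⟨v - 1, by omega⟩))).val
  else if h : n ≤ v ∧ v < 2 * n then (x (Sum.inl ⟨v - n, by omega⟩)).val
  else 0

/-- How the counting gate at an internal node changes its qutrit `z`, given the states `l`, `r` of
its children. The gate at the root only records whether two or more excitations were counted. -/
def countStep (isRoot : Prop) [Decidable isRoot] (l r : ℕ) (z : Fin 3) : Fin 3 :=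
  if isRoot then
    if (l = 0 ∧ r = 0) ∨ (l = 1 ∧ r = 0) ∨ (l = 0 ∧ r = 1) then z else z + 1
  else
    if l = 0 ∧ r = 0 then z
    else if (l = 1 ∧ r = 0) ∨ (l = 0 ∧ r = 1) then z + 1
    else 2 - z

/-- The action of the counting gate at the internal node `v + 1` on basis states. -/
def countMap (v : Fin (n - 1)) (x : Config (siteDim n T)) : Config (siteDim n T) :=
  Function.update x (Sum.inr (Sum.inl v))
    (countStep (v.val = 0) (nodeState x (2 * (v.val + 1))) (nodeState x (2 * (v.val + 1) + 1))
      (x (Sum.inr (Sum.inl v))))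

/-- The counting gate at the internal node `v + 1`, a permutation of the basis states. -/
def countGate (v : Fin (n - 1)) : Op (siteDim n T) :=
  fun y x => if y = countMap v x then 1 else 0

variable (n T) in
/-- The gates of the circuit, in the order of time `t = 1, 2, …`: the counting gates
`U_1, …, U_{n-1}` at the nodes `n - 1, …, 1`, then `U_{n-2}†, …, U_1†`, then identity gates. -/
def treeGate (t : ℕ) : Op (siteDim n T) :=
  if h : 1 ≤ t ∧ t < n then countGate ⟨n - t - 1, by omega⟩
  else if h : n ≤ t ∧ t + 3 ≤ 2 * n then
    (countGate (n := n) (T := T) ⟨t + 1 - n, by omega⟩)ᴴ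
  else 1

/-- The state of the `t`-th clock qubit, `1 ≤ t ≤ T`, extended by `1` at `t = 0` and by `0` at
`t > T`; legal clock states are `1^t 0^(T-t)`. -/
def clockBit (x : Config (siteDim n T)) (t : ℕ) : ℕ :=
  if t = 0 then 1
  else if h : t - 1 < T then (x (Sum.inr (Sum.inr ⟨t - 1, h⟩))).val
  else 0

/-- The projector onto the span of the basis states with property `p`. -/
def basisProj (p : Config (siteDim n T) → Prop) [DecidablePred p] : Op (siteDim n T) :=
  Matrix.diagonal (fun x => if p x then 1 else 0)

/-- The clock transition `|110⟩⟨100|` on the clock qubits `t - 1, t, t + 1`, where `t = s + 1`. -/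
def clockStep (s : Fin T) : Op (siteDim n T) :=
  fun y x =>
    if (clockBit x s.val = 1 ∧ clockBit x (s.val + 1) = 0 ∧ clockBit x (s.val + 2) = 0) ∧
      y = Function.update x (Sum.inr (Sum.inr s)) (1 : Fin 2) then 1 else 0

variable (n T) in
/-- `∑_{1 ≤ t < T} |01⟩⟨01|_{t,t+1}` on the clock. -/
def hClock : Op (siteDim n T) :=
  ∑ t ∈ Finset.Ico 1 T, basisProj (fun x => clockBit x t = 0 ∧ clockBit x (t + 1) = 1)

/-- The propagation term at time `t = s + 1`:
`|100⟩⟨100| + |110⟩⟨110| - U_t ⊗ |110⟩⟨100| - U_t† ⊗ |100⟩⟨110|`. -/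
def hPropTerm (s : Fin T) : Op (siteDim n T) :=
  basisProj (fun x => clockBit x s.val = 1 ∧ clockBit x (s.val + 1) = 0 ∧
      clockBit x (s.val + 2) = 0)
    + basisProj (fun x => clockBit x s.val = 1 ∧ clockBit x (s.val + 1) = 1 ∧
      clockBit x (s.val + 2) = 0)
    - treeGate n T (s.val + 1) * clockStep s - (treeGate n T (s.val + 1) * clockStep s)ᴴ

variable (n T) in
/-- The sum of the propagation terms. -/
def hProp : Op (siteDim n T) := ∑ s : Fin T, hPropTerm s

variable (n T) in
/-- Penalizes an ancilla qutrit that is not in state `0` before its first gate; for the ancilla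
at the node `v + 1` this is the gate at time `n - (v + 1)`. -/
def hIn : Op (siteDim n T) :=
  ∑ v : Fin (n - 1),
    basisProj (fun x => nodeState x (v.val + 1) ≠ 0 ∧ clockBit x (n - (v.val + 1)) = 0)

variable (n T) in
/-- Penalizes a root qutrit that is not in state `0` from time `n - 1` on. -/
def hOut : Op (siteDim n T) :=
  basisProj (fun x => nodeState x 1 ≠ 0 ∧ clockBit x (n - 1) = 1)

variable (n T) in
/-- The circuit Hamiltonian of the uncomputed tree counting circuit on `n` qubits, padded with
identity gates to the length `T`. -/
def treeCircuitHamiltonian (Jclock Jprop Jin Jout : ℝ) : Op (siteDim n T) :=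
  (Jclock : ℂ) • hClock n T + (Jprop : ℂ) • hProp n T + (Jin : ℂ) • hIn n T
    + (Jout : ℂ) • hOut n T

end TreeCircuit

end GapSim

open GapSim

namespace GapSim

/-! ### Spectra of matrices and quadratic forms -/

section Spectrum

variable {m : Type} [Fintype m]

/-! Every gate permutes the computational basis. For an input `d`, the computation therefore visits
the `T + 1` basis states `history T d 0, …, history T d T`. These states are all distinct, distinct
inputs give disjoint paths, and together they exhaust the basis states with a legal clock
(`history_inj`, `exists_history_eq`). All four weights are given one value `J`. The Hamiltonian is
then `J` times a diagonal count of violated constraints plus `J` times a sum of squares `Kᴴ * K` of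
difference operators along the clock transitions (`hPropTerm_eq`, `treeCircuitHamiltonian_eq`). On
legal clock states this is the Laplacian of a disjoint union of paths with a nonnegative potential.

Every illegal clock state violates a constraint. An input is good if its ancillas are `0` and it has
at most one excitation; its path violates nothing. Any other path violates the input constraint at
time `0`, or the output constraint at time `n - 1`, because the tree adds excitations with
saturation at `2` (`countValue_eq_min`, `sum_subtreeWeight`). Poincaré inequalities on paths
(`sum_paths_le`) with `J = 2 (T + 1) ^ 2` give `1 ≤ H + Q`, where `Q` projects onto the uniform
superpositions of the good paths and `H * Q = 0`. So the ground energy and the spread are exactly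
`0`, and the gap is at least `1`, the gap of `H_A` (`isGroundspace_HA`).

From time `2n - 3` on, a good computation has restored its input. The superposition restricted to
those times is a product state, and the projector onto all such states is exactly `P ⊗ Panc`
(`encoded_projector_eq`). Full and restricted superpositions have overlap `√(1 - (2n - 3) / (T +
1))`, so `T` of order `n / ε ^ 2` makes the projectors `ε`-close (`norm_projector_sub_le`).

Locality: each clock, input and output constraint involves only qudits of some propagation term,
namely a node, its two children and three clock qubits. Hence there are at most `T` terms on at most
six qudits. A tree qudit occurs only when its own gate or its parent's gate is applied or undone,
and a clock qubit only in neighbouring steps (`card_steps_le`). -/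

theorem mem_spectrum_real_iff [DecidableEq m] (A : Matrix m m ℂ) (μ : ℝ) :
    μ ∈ spectrum ℝ A ↔ ∃ v : m → ℂ, v ≠ 0 ∧ A *ᵥ v = (μ : ℂ) • v := by
  rw [spectrum.mem_iff, Matrix.isUnit_iff_isUnit_det, isUnit_iff_ne_zero, not_not,
    ← Matrix.exists_mulVec_eq_zero_iff]
  refine exists_congr fun v => and_congr_right fun _ => ?_
  have h : (algebraMap ℝ (Matrix m m ℂ)) μ = (μ : ℂ) • 1 := by
    ext i j
    simp [Matrix.algebraMap_matrix_apply, Matrix.one_apply]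
  rw [h, Matrix.sub_mulVec, Matrix.smul_mulVec, Matrix.one_mulVec, sub_eq_zero]
  exact eq_comm

theorem star_dotProduct_self (v : m → ℂ) : star v ⬝ᵥ v = ((∑ i, ‖v i‖ ^ 2 : ℝ) : ℂ) := by
  simp only [dotProduct, Pi.star_apply, Complex.ofReal_sum]
  refine Finset.sum_congr rfl fun i _ => ?_
  rw [Complex.star_def, Complex.conj_mul']
  push_cast
  rfl

theorem le_of_mem_spectrum_of_form [DecidableEq m] {A : Matrix m m ℂ} {c : ℝ}
    (h : ∀ v : m → ℂ, c * ∑ i, ‖v i‖ ^ 2 ≤ (star v ⬝ᵥ (A *ᵥ v)).re) :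
    ∀ μ ∈ spectrum ℝ A, c ≤ μ := by
  intro μ hμ
  obtain ⟨v, hv, hAv⟩ := (mem_spectrum_real_iff A μ).1 hμ
  have h1 := h v
  rw [hAv, dotProduct_smul, star_dotProduct_self, smul_eq_mul, ← Complex.ofReal_mul,
    Complex.ofReal_re] at h1
  have hpos : 0 < ∑ i, ‖v i‖ ^ 2 := by
    obtain ⟨i, hi⟩ := Function.ne_iff.1 hv
    refine Finset.sum_pos' (fun _ _ => by positivity) ⟨i, Finset.mem_univ _, ?_⟩
    have : v i ≠ 0 := hi
    positivity
  exact le_of_mul_le_mul_right h1 hpos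

theorem form_conjTranspose_mul_self {l : Type} [Fintype l] (K : Matrix l m ℂ) (v : m → ℂ) :
    star v ⬝ᵥ ((Kᴴ * K) *ᵥ v) = ((∑ i, ‖(K *ᵥ v) i‖ ^ 2 : ℝ) : ℂ) := by
  classical
  rw [← star_dotProduct_self, ← Matrix.mulVec_mulVec, Matrix.dotProduct_mulVec,
    Matrix.star_mulVec]

theorem form_diagonal [DecidableEq m] (V : m → ℝ) (v : m → ℂ) :
    star v ⬝ᵥ (Matrix.diagonal (fun x => (V x : ℂ)) *ᵥ v) = ((∑ i, V i * ‖v i‖ ^ 2 : ℝ) : ℂ) := by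
  simp only [dotProduct, Pi.star_apply, Complex.ofReal_sum, Matrix.mulVec_diagonal]
  refine Finset.sum_congr rfl fun i _ => ?_
  have := Complex.conj_mul' (v i)
  rw [Complex.star_def]
  push_cast
  rw [← this]
  ring

/-- A frustration-free Hamiltonian with a zero-energy projector `P` such that `1 ≤ H + P`. -/
theorem isQuasiGroundspace_of_form [DecidableEq m] {H P : Matrix m m ℂ} (hH : H.IsHermitian)
    (hP : IsProjector P) (hHP : H * P = 0) (hP0 : P ≠ 0)
    (hpos : ∀ v : m → ℂ, 0 ≤ (star v ⬝ᵥ (H *ᵥ v)).re)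
    (hgap : ∀ v : m → ℂ, ∑ i, ‖v i‖ ^ 2 ≤ (star v ⬝ᵥ ((H + P) *ᵥ v)).re) :
    IsLeast (spectrum ℝ H) 0 ∧ IsQuasiGroundspace H P 0 1 := by
  have hPH : P * H = 0 := by
    have := congrArg Matrix.conjTranspose hHP
    rwa [Matrix.conjTranspose_mul, hP.1.eq, hH.eq, Matrix.conjTranspose_zero] at this
  have hleast : IsLeast (spectrum ℝ H) 0 := by
    refine ⟨?_, le_of_mem_spectrum_of_form (by simpa using hpos)⟩
    rw [mem_spectrum_real_iff]
    -- Since `H * P = 0`, any nonzero column of `P` is an eigenvector of energy `0`.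
    obtain ⟨j, hj⟩ : ∃ j, P.col j ≠ 0 := by
      by_contra hcon
      push Not at hcon
      apply hP0
      ext i j
      exact congrFun (hcon j) i
    refine ⟨P.col j, hj, ?_⟩
    rw [← Matrix.mulVec_single_one, Matrix.mulVec_mulVec, hHP]
    simp only [Matrix.mulVec_single_one, Complex.ofReal_zero, zero_smul]
    rfl
  refine ⟨hleast, hH, hP, one_pos, le_rfl, one_pos, by rw [hHP, hPH], 0, hleast, ?_, ?_⟩
  · simp [hPH]
  -- With `E = 0` and `H * P = P * H = 0`, the operator in the gap condition collapses to `H + P`.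
  · have : (1 - P) * (H - ((0 : ℝ) : ℂ) • 1) * (1 - P) + ((1 : ℝ) : ℂ) • P = H + P := by
      simp [sub_mul, mul_sub, hHP, hPH]
    rw [this]
    exact le_of_mem_spectrum_of_form (by simpa using hgap)

end Spectrum

/-! ### Operators acting on few qudits -/

section ActsOn

variable {ι : Type} [Fintype ι] [DecidableEq ι] {d : ι → ℕ}

/-- Replaces the local matrix by conditions on entries, which pass easily to sums and adjoints.
Conversely, the local matrix is read off from any extension of its indices to full configurations;
the second condition makes the choice irrelevant. -/
theorem actsOn_iff (A : Op d) (S : Finset ι) :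
    ActsOn A S ↔ (∀ x y, (∃ i, i ∉ S ∧ x i ≠ y i) → A x y = 0) ∧
      ∀ x y x' y', (∀ i, i ∉ S → x i = y i) → (∀ i, i ∉ S → x' i = y' i) →
        (∀ i ∈ S, x i = x' i) → (∀ i ∈ S, y i = y' i) → A x y = A x' y' := by
  constructor
  · rintro ⟨B, hB⟩
    refine ⟨fun x y ⟨i, hi, hne⟩ => ?_, fun x y x' y' h h' hx hy => ?_⟩
    · rw [hB, if_neg]
      exact fun h => hne (h i hi)
    · rw [hB, hB, if_pos h, if_pos h']
      congr 1
      · funext i; exact hx i i.2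
      · funext i; exact hy i i.2
  · rintro ⟨h0, h1⟩
    classical
    refine ⟨fun u v => if h : ∃ x y : Config d, (∀ i, i ∉ S → x i = y i) ∧
      (fun i : S => x i) = u ∧ (fun i : S => y i) = v then A h.choose h.choose_spec.choose else 0,
      fun x y => ?_⟩
    split_ifs with hxy
    · have hex : ∃ x' y' : Config d, (∀ i, i ∉ S → x' i = y' i) ∧
        (fun i : S => x' i) = (fun i : S => x i) ∧ (fun i : S => y' i) = (fun i : S => y i) :=
        ⟨x, y, hxy, rfl, rfl⟩
      dsimp only
      rw [dif_pos hex]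
      obtain ⟨a, b, c⟩ := hex.choose_spec.choose_spec
      refine h1 _ _ _ _ hxy a (fun i hi => ?_) (fun i hi => ?_)
      · exact (congrFun b ⟨i, hi⟩).symm
      · exact (congrFun c ⟨i, hi⟩).symm
    · push Not at hxy
      exact h0 x y hxy

theorem ActsOn.add {A B : Op d} {S : Finset ι} (hA : ActsOn A S) (hB : ActsOn B S) :
    ActsOn (A + B) S := by
  rw [actsOn_iff] at *
  refine ⟨fun x y h => ?_, fun x y x' y' h1 h2 h3 h4 => ?_⟩
  · simp [hA.1 x y h, hB.1 x y h]
  · simp [hA.2 x y x' y' h1 h2 h3 h4, hB.2 x y x' y' h1 h2 h3 h4]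

theorem ActsOn.smul {A : Op d} {S : Finset ι} (c : ℂ) (hA : ActsOn A S) :
    ActsOn (c • A) S := by
  rw [actsOn_iff] at *
  refine ⟨fun x y h => ?_, fun x y x' y' h1 h2 h3 h4 => ?_⟩
  · simp [hA.1 x y h]
  · simp [hA.2 x y x' y' h1 h2 h3 h4]

theorem ActsOn.sub {A B : Op d} {S : Finset ι} (hA : ActsOn A S) (hB : ActsOn B S) :
    ActsOn (A - B) S := by
  have := hA.add (hB.smul (-1))
  rwa [neg_one_smul, ← sub_eq_add_neg] at this

theorem ActsOn.conjTranspose {A : Op d} {S : Finset ι} (hA : ActsOn A S) :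
    ActsOn Aᴴ S := by
  rw [actsOn_iff] at *
  refine ⟨fun x y ⟨i, hi, h⟩ => ?_, fun x y x' y' h1 h2 h3 h4 => ?_⟩
  · rw [Matrix.conjTranspose_apply, hA.1 y x ⟨i, hi, h.symm⟩, star_zero]
  · rw [Matrix.conjTranspose_apply, Matrix.conjTranspose_apply,
      hA.2 y x y' x' (fun i hi => (h1 i hi).symm) (fun i hi => (h2 i hi).symm) h4 h3]

theorem ActsOn.zero (S : Finset ι) : ActsOn (0 : Op d) S := ⟨0, by simp⟩

theorem ActsOn.sum {κ : Type} (s : Finset κ) {A : κ → Op d} {S : Finset ι}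
    (hA : ∀ k ∈ s, ActsOn (A k) S) : ActsOn (∑ k ∈ s, A k) S := by
  classical
  induction s using Finset.induction_on with
  | empty => simpa using ActsOn.zero S
  | insert a s ha ih =>
    rw [Finset.sum_insert ha]
    exact (hA a (by simp)).add (ih fun k hk => hA k (by simp [hk]))

theorem actsOn_diagonal {p : Config d → Prop} [DecidablePred p] {S : Finset ι}
    (hp : ∀ x x', (∀ i ∈ S, x i = x' i) → (p x ↔ p x')) :
    ActsOn (Matrix.diagonal (fun x => if p x then (1 : ℂ) else 0)) S := by
  rw [actsOn_iff]
  refine ⟨fun x y ⟨i, hi, h⟩ => ?_, fun x y x' y' h1 h2 h3 h4 => ?_⟩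
  · exact Matrix.diagonal_apply_ne _ fun hxy => h (congrFun hxy i)
  · have hiff : x = y ↔ x' = y' := by
      constructor
      · rintro rfl
        funext i
        by_cases hi : i ∈ S
        · rw [← h3 i hi, ← h4 i hi]
        · exact h2 i hi
      · rintro rfl
        funext i
        by_cases hi : i ∈ S
        · rw [h3 i hi, h4 i hi]
        · exact h1 i hi
    simp only [Matrix.diagonal_apply, hiff, hp x x' h3]

/-- Partial maps of basis states which change and depend on the qudits in `S` only. -/
theorem actsOn_partialMap {p : Config d → Prop} [DecidablePred p] {f : Config d → Config d}
    {A : Op d} (hA : ∀ y x, A y x = if p x ∧ y = f x then 1 else 0)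
    {S : Finset ι} (hp : ∀ x x', (∀ i ∈ S, x i = x' i) → (p x ↔ p x'))
    (hf : ∀ x i, i ∉ S → f x i = x i)
    (hfS : ∀ x x', (∀ i ∈ S, x i = x' i) → ∀ i ∈ S, f x i = f x' i) :
    ActsOn A S := by
  rw [actsOn_iff]
  refine ⟨fun y x ⟨i, hi, h⟩ => ?_, fun y x y' x' h1 h2 h3 h4 => ?_⟩
  · rw [hA, if_neg]
    rintro ⟨-, rfl⟩
    exact h (hf x i hi)
  · have hiff : y = f x ↔ y' = f x' := by
      constructor
      · rintro rfl
        funext i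
        by_cases hi : i ∈ S
        · rw [← h3 i hi, hfS x x' h4 i hi]
        · rw [h2 i hi, hf x' i hi]
      · rintro rfl
        funext i
        by_cases hi : i ∈ S
        · rw [h3 i hi, hfS x x' h4 i hi]
        · rw [h1 i hi, hf x i hi]
    simp only [hA, hiff, hp x x' h4]

end ActsOn

/-! ### Laplacians of paths -/

section Paths

/-- Telescoping and Cauchy–Schwarz. All `T` steps are kept, so that the bound is uniform in `s` and
`t`. -/
theorem norm_sub_sq_le_sum_steps (T : ℕ) (f : ℕ → ℂ) {s t : ℕ} (hs : s ≤ T) (ht : t ≤ T) :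
    ‖f t - f s‖ ^ 2 ≤ T * ∑ i ∈ Finset.range T, ‖f (i + 1) - f i‖ ^ 2 := by
  wlog hst : s ≤ t generalizing s t
  · rw [norm_sub_rev]
    exact this ht hs (by omega)
  have h1 : ‖f t - f s‖ ≤ ∑ i ∈ Finset.range T, ‖f (i + 1) - f i‖ := by
    rw [← Finset.sum_Ico_sub f hst]
    refine (norm_sum_le _ _).trans ?_
    refine Finset.sum_le_sum_of_subset_of_nonneg ?_ fun _ _ _ => norm_nonneg _
    intro i hi
    simp only [Finset.mem_Ico, Finset.mem_range] at *
    omega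
  calc ‖f t - f s‖ ^ 2 ≤ (∑ i ∈ Finset.range T, ‖f (i + 1) - f i‖) ^ 2 := by gcongr
    _ ≤ _ := by
      have := sq_sum_le_card_mul_sum_sq (s := Finset.range T) (f := fun i => ‖f (i + 1) - f i‖)
      simpa using this

/-- Summing `‖f t - f s‖ ^ 2` over all pairs gives `2 (T + 1) ∑ ‖f t‖ ^ 2 - 2 ‖∑ f t‖ ^ 2`, while
each summand is bounded by the steps. The last term is the squared overlap with the uniform
superposition. -/
theorem path_poincare (T : ℕ) (f : ℕ → ℂ) :
    ∑ t ∈ Finset.range (T + 1), ‖f t‖ ^ 2 ≤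
      (T + 1) ^ 2 * ∑ i ∈ Finset.range T, ‖f (i + 1) - f i‖ ^ 2 +
        ‖∑ t ∈ Finset.range (T + 1), f t‖ ^ 2 / (T + 1) := by
  set D := ∑ i ∈ Finset.range T, ‖f (i + 1) - f i‖ ^ 2 with hD
  have hD0 : 0 ≤ D := Finset.sum_nonneg fun _ _ => by positivity
  set F := ∑ t ∈ Finset.range (T + 1), ‖f t‖ ^ 2 with hF
  have hcross : ∑ s ∈ Finset.range (T + 1), ∑ t ∈ Finset.range (T + 1), inner ℝ (f t) (f s) =
      ‖∑ t ∈ Finset.range (T + 1), f t‖ ^ 2 := by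
    rw [← real_inner_self_eq_norm_sq, inner_sum]
    exact Finset.sum_congr rfl fun s _ => (sum_inner _ _ _).symm
  have hid : ∑ s ∈ Finset.range (T + 1), ∑ t ∈ Finset.range (T + 1), ‖f t - f s‖ ^ 2 =
      2 * (T + 1) * F - 2 * ‖∑ t ∈ Finset.range (T + 1), f t‖ ^ 2 := by
    rw [← hcross]
    simp only [norm_sub_sq_real, Finset.sum_add_distrib, Finset.sum_sub_distrib, ← Finset.mul_sum,
      Finset.sum_const, Finset.card_range, nsmul_eq_mul, ← hF]
    push_cast
    ring
  have hle : ∑ s ∈ Finset.range (T + 1), ∑ t ∈ Finset.range (T + 1), ‖f t - f s‖ ^ 2 ≤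
      ∑ s ∈ Finset.range (T + 1), ∑ t ∈ Finset.range (T + 1), T * D := by
    refine Finset.sum_le_sum fun s hs => Finset.sum_le_sum fun t ht => ?_
    simp only [Finset.mem_range] at hs ht
    exact norm_sub_sq_le_sum_steps T f (by omega) (by omega)
  simp only [Finset.sum_const, Finset.card_range, nsmul_eq_mul, hid] at hle
  push_cast at hle
  have hN : (0 : ℝ) < (T : ℝ) + 1 := by positivity
  have hT0 : (0 : ℝ) ≤ T := by positivity
  have key : F * (T + 1) ≤ ((T + 1) ^ 2 * D) * (T + 1) + ‖∑ t ∈ Finset.range (T + 1), f t‖ ^ 2 := by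
    have h2 : (0:ℝ) ≤ (T + 1) * D := by positivity
    nlinarith [mul_nonneg h2 hT0, mul_nonneg (mul_nonneg h2 hT0) hT0, mul_nonneg (mul_nonneg h2 hT0) hN.le]
  rw [← le_div_iff₀ hN] at key
  refine key.trans (le_of_eq ?_)
  field_simp

/-- Compare every value with the one at `t₀`, using `(a + b) ^ 2 ≤ 2 a ^ 2 + 2 b ^ 2`: a potential
at a single vertex controls the whole path. -/
theorem path_penalized (T : ℕ) (f : ℕ → ℂ) {t₀ : ℕ} (h₀ : t₀ ≤ T) :
    ∑ t ∈ Finset.range (T + 1), ‖f t‖ ^ 2 ≤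
      2 * (T + 1) ^ 2 * ∑ i ∈ Finset.range T, ‖f (i + 1) - f i‖ ^ 2 +
        2 * (T + 1) * ‖f t₀‖ ^ 2 := by
  set D := ∑ i ∈ Finset.range T, ‖f (i + 1) - f i‖ ^ 2 with hD
  have hD0 : 0 ≤ D := Finset.sum_nonneg fun _ _ => by positivity
  have hstep : ∀ t ∈ Finset.range (T + 1), ‖f t‖ ^ 2 ≤ 2 * (T * D) + 2 * ‖f t₀‖ ^ 2 := by
    intro t ht
    simp only [Finset.mem_range] at ht
    have h1 := norm_sub_sq_le_sum_steps T f h₀ (t := t) (by omega)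
    have h2 : ‖f t‖ ≤ ‖f t - f t₀‖ + ‖f t₀‖ := by
      simpa using norm_add_le (f t - f t₀) (f t₀)
    have h3 : ‖f t‖ ^ 2 ≤ (‖f t - f t₀‖ + ‖f t₀‖) ^ 2 := by gcongr
    nlinarith [sq_nonneg (‖f t - f t₀‖ - ‖f t₀‖)]
  refine (Finset.sum_le_sum hstep).trans ?_
  simp only [Finset.sum_const, Finset.card_range, nsmul_eq_mul]
  push_cast
  have : (0 : ℝ) ≤ (T + 1) * D := by positivity
  nlinarith

/-- Gap of the Laplacian of a disjoint union of paths `h d 0, …, h d T` with a potential `V` that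
is at least `1` off the paths and large somewhere on every path that is not `good`. -/
theorem sum_paths_le {X D : Type} [Fintype X] [DecidableEq X] [Fintype D] (T : ℕ)
    (h : D → ℕ → X)
    (hinj : ∀ d d' t t', t ≤ T → t' ≤ T → h d t = h d' t' → d = d' ∧ t = t')
    (V : X → ℝ) (hV : ∀ x, 0 ≤ V x) (hoff : ∀ x, (∀ d t, t ≤ T → h d t ≠ x) → 1 ≤ V x)
    (good : D → Prop) [DecidablePred good]
    (hbad : ∀ d, ¬ good d → ∃ t ≤ T, 2 * ((T : ℝ) + 1) ≤ V (h d t))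
    {J : ℝ} (hJ : 2 * ((T : ℝ) + 1) ^ 2 ≤ J) (E : Fin T → ℝ) (ψ : X → ℂ)
    (hE : ∀ s : Fin T, ∑ d, ‖ψ (h d (s + 1)) - ψ (h d s)‖ ^ 2 ≤ E s) :
    ∑ x, ‖ψ x‖ ^ 2 ≤ J * ∑ s, E s + ∑ x, V x * ‖ψ x‖ ^ 2 +
      ∑ d with good d, ‖∑ t ∈ Finset.range (T + 1), ψ (h d t)‖ ^ 2 / (T + 1) := by
  classical
  let e : D × ℕ → X := fun p => h p.1 p.2
  let I : Finset (D × ℕ) := Finset.univ ×ˢ Finset.range (T + 1)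
  have heinj : Set.InjOn e I := by
    rintro ⟨d, t⟩ hp ⟨d', t'⟩ hp' heq
    simp only [I, Finset.coe_product, Finset.coe_univ, Set.mem_prod, Set.mem_univ, true_and,
      Finset.coe_range, Set.mem_Iio] at hp hp'
    obtain ⟨rfl, rfl⟩ := hinj d d' t t' (by omega) (by omega) heq
    rfl
  have hsplit : ∀ g : X → ℝ, ∑ x, g x =
      ∑ d, ∑ t ∈ Finset.range (T + 1), g (h d t) + ∑ x ∈ (I.image e)ᶜ, g x := by
    intro g
    rw [← Finset.sum_add_sum_compl (I.image e) g, Finset.sum_image heinj, Finset.sum_product]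
  have hcompl : ∑ x ∈ (I.image e)ᶜ, ‖ψ x‖ ^ 2 ≤ ∑ x ∈ (I.image e)ᶜ, V x * ‖ψ x‖ ^ 2 := by
    refine Finset.sum_le_sum fun x hx => ?_
    have : 1 ≤ V x := by
      refine hoff x fun d t ht heq => ?_
      rw [Finset.mem_compl, Finset.mem_image] at hx
      exact hx ⟨(d, t), by simp [I]; omega, heq⟩
    nlinarith [sq_nonneg ‖ψ x‖]
  have hJ0 : 0 ≤ J := le_trans (by positivity) hJ
  have hsum : ∑ d, ∑ i ∈ Finset.range T, ‖ψ (h d (i + 1)) - ψ (h d i)‖ ^ 2 ≤ ∑ s, E s := by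
    rw [Finset.sum_comm, Finset.sum_range]
    exact Finset.sum_le_sum fun s _ => hE s
  -- A good path pays with its overlap term through `path_poincare`. Any other path is anchored at
  -- its penalized vertex; the thresholds on `J` and `V` are the two constants of `path_penalized`.
  have hpath : ∀ d, ∑ t ∈ Finset.range (T + 1), ‖ψ (h d t)‖ ^ 2 ≤
      J * ∑ i ∈ Finset.range T, ‖ψ (h d (i + 1)) - ψ (h d i)‖ ^ 2 +
        ∑ t ∈ Finset.range (T + 1), V (h d t) * ‖ψ (h d t)‖ ^ 2 +
        if good d then ‖∑ t ∈ Finset.range (T + 1), ψ (h d t)‖ ^ 2 / (T + 1) else 0 := by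
    intro d
    have hD0 : 0 ≤ ∑ i ∈ Finset.range T, ‖ψ (h d (i + 1)) - ψ (h d i)‖ ^ 2 :=
      Finset.sum_nonneg fun _ _ => by positivity
    have hVn : ∀ t ∈ Finset.range (T + 1), 0 ≤ V (h d t) * ‖ψ (h d t)‖ ^ 2 := fun t _ =>
      mul_nonneg (hV _) (by positivity)
    have hJD := mul_le_mul_of_nonneg_right hJ hD0
    split_ifs with hg
    · have h1 := path_poincare T (fun t => ψ (h d t))
      have h2 := Finset.sum_nonneg hVn
      have h3 : (0:ℝ) ≤ ((T : ℝ) + 1) ^ 2 *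
        ∑ i ∈ Finset.range T, ‖ψ (h d (i + 1)) - ψ (h d i)‖ ^ 2 := by positivity
      linarith
    · obtain ⟨t₀, ht₀, hVt⟩ := hbad d hg
      have h1 := path_penalized T (fun t => ψ (h d t)) ht₀
      have h2 := Finset.single_le_sum hVn (a := t₀) (by simp; omega)
      have h3 := mul_le_mul_of_nonneg_right hVt (sq_nonneg ‖ψ (h d t₀)‖)
      linarith
  rw [hsplit (fun x => ‖ψ x‖ ^ 2), hsplit (fun x => V x * ‖ψ x‖ ^ 2), Finset.sum_filter]
  have htot := Finset.sum_le_sum fun d (_ : d ∈ Finset.univ) => hpath d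
  simp only [Finset.sum_add_distrib, ← Finset.mul_sum] at htot
  have := mul_le_mul_of_nonneg_left hsum hJ0
  linarith

end Paths

/-! ### Projectors onto the columns of isometries -/

section Isometries

variable {m g : Type} [Fintype m] [Fintype g] [DecidableEq g]

theorem isProjector_of_isometry {A : Matrix m g ℂ} (hA : Aᴴ * A = 1) : IsProjector (A * Aᴴ) := by
  refine ⟨Matrix.isHermitian_mul_conjTranspose_self A, ?_⟩
  rw [Matrix.mul_assoc, ← Matrix.mul_assoc Aᴴ, hA, Matrix.one_mul]

theorem norm_le_one_of_isometry {A : Matrix m g ℂ} (hA : Aᴴ * A = 1) : ‖A‖ ≤ 1 := by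
  have h := Matrix.l2_opNorm_conjTranspose_mul_self A
  rw [hA, ← Matrix.diagonal_one, Matrix.l2_opNorm_diagonal] at h
  have h1 : ‖(fun _ => 1 : g → ℂ)‖ ≤ 1 := (pi_norm_le_iff_of_nonneg zero_le_one).2 (by simp)
  rw [h] at h1
  nlinarith [norm_nonneg A]

/-- Isometries with overlap `Aᴴ * B = ρ` have column projectors at distance at most
`√(8 (1 - ρ))`. -/
theorem norm_projector_sub_le [DecidableEq m] {A B : Matrix m g ℂ} (hA : Aᴴ * A = 1) (hB : Bᴴ * B = 1) {ρ ε : ℝ}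
    (hAB : Aᴴ * B = (ρ : ℂ) • 1) (hε : 0 ≤ ε) (hρ : 8 * (1 - ρ) ≤ ε ^ 2) :
    ‖A * Aᴴ - B * Bᴴ‖ ≤ ε := by
  have hBA : Bᴴ * A = (ρ : ℂ) • 1 := by
    have := congrArg Matrix.conjTranspose hAB
    simpa using this
  -- The overlap is a real scalar, so `A - B` is a multiple of an isometry, with squared norm `2 -
  -- 2ρ ≤ ε ^ 2 / 4`.
  have hsq : (A - B)ᴴ * (A - B) = Matrix.diagonal (fun _ : g => ((2 - 2 * ρ : ℝ) : ℂ)) := by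
    rw [Matrix.conjTranspose_sub, Matrix.sub_mul, Matrix.mul_sub, Matrix.mul_sub, hA, hB, hAB, hBA]
    ext i j
    by_cases hij : i = j
    · subst hij
      simp
      ring
    · simp [hij]
  have hn := Matrix.l2_opNorm_conjTranspose_mul_self (A - B)
  rw [hsq, Matrix.l2_opNorm_diagonal] at hn
  have hδ : ‖A - B‖ ≤ ε / 2 := by
    rcases isEmpty_or_nonempty g with hg | hg
    · have : A - B = 0 := by
        ext i j
        exact hg.elim j
      rw [this, norm_zero]
      positivity
    · rw [pi_norm_const, Complex.norm_real, Real.norm_eq_abs] at hn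
      obtain ⟨j⟩ := hg
      have h0 : 0 ≤ 2 - 2 * ρ := by
        have h1 := congrFun (congrFun hsq j) j
        rw [Matrix.diagonal_apply_eq, Matrix.mul_apply] at h1
        have h2 : ∑ i, (A - B)ᴴ j i * (A - B) i j = ((∑ i, ‖(A - B) i j‖ ^ 2 : ℝ) : ℂ) := by
          rw [← star_dotProduct_self]
          rfl
        rw [h2, Complex.ofReal_inj] at h1
        rw [← h1]
        exact Finset.sum_nonneg fun _ _ => by positivity
      rw [abs_of_nonneg h0] at hn
      refine abs_le_of_sq_le_sq' ?_ (by positivity) |>.2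
      nlinarith
  -- Each of the two summands has norm at most `‖A - B‖ ≤ ε / 2`.
  have hdec : A * Aᴴ - B * Bᴴ = (A - B) * Aᴴ + B * (A - B)ᴴ := by
    rw [Matrix.conjTranspose_sub, Matrix.sub_mul, Matrix.mul_sub]
    abel
  rw [hdec]
  refine (norm_add_le _ _).trans ?_
  have h1 := Matrix.l2_opNorm_mul (A - B) Aᴴ
  have h2 := Matrix.l2_opNorm_mul B (A - B)ᴴ
  rw [Matrix.l2_opNorm_conjTranspose] at h1 h2
  have h3 := norm_le_one_of_isometry hA
  have h4 := norm_le_one_of_isometry hB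
  nlinarith [norm_nonneg (A - B)]

end Isometries

/-! ### The gates as permutations of the basis states of qubits and qutrits -/

section Gates

variable {n T : ℕ}

/-- Basis states of the original qubits and of the ancilla qutrits. -/
abbrev TreeData (n : ℕ) : Type := (Fin n → Fin 2) × (Fin (n - 1) → Fin 3)

/-- The basis state with given data and clock. -/
def joinConf (d : TreeData n) (c : Fin T → Fin 2) : Config (siteDim n T)
  | Sum.inl i => d.1 i
  | Sum.inr (Sum.inl v) => d.2 v
  | Sum.inr (Sum.inr s) => c s

/-- The data part of a basis state. -/
def dataOf (x : Config (siteDim n T)) : TreeData n :=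
  (fun i => x (Sum.inl i), fun v => x (Sum.inr (Sum.inl v)))

/-- The clock part of a basis state. -/
def clockOf (x : Config (siteDim n T)) : Fin T → Fin 2 := fun s => x (Sum.inr (Sum.inr s))

@[simp] theorem dataOf_joinConf (d : TreeData n) (c : Fin T → Fin 2) :
    dataOf (joinConf d c) = d := rfl

@[simp] theorem clockOf_joinConf (d : TreeData n) (c : Fin T → Fin 2) :
    clockOf (joinConf d c) = c := rfl

theorem conf_ext {x y : Config (siteDim n T)} (h1 : dataOf x = dataOf y)
    (h2 : clockOf x = clockOf y) : x = y := by
  funext i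
  rcases i with i | v | s
  · exact congrFun (congrArg Prod.fst h1) i
  · exact congrFun (congrArg Prod.snd h1) v
  · exact congrFun h2 s

theorem eq_joinConf_iff {x : Config (siteDim n T)} {d : TreeData n} {c : Fin T → Fin 2} :
    x = joinConf d c ↔ dataOf x = d ∧ clockOf x = c :=
  ⟨by rintro rfl; exact ⟨rfl, rfl⟩, fun h => conf_ext h.1 h.2⟩

/-- The state of a node of the tree. -/
def dataNode (d : TreeData n) (v : ℕ) : ℕ :=
  if h : 1 ≤ v ∧ v < n then (d.2 ⟨v - 1, by omega⟩).val
  else if h : n ≤ v ∧ v < 2 * n then (d.1 ⟨v - n, by omega⟩).val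
  else 0

theorem nodeState_eq (x : Config (siteDim n T)) (v : ℕ) :
    nodeState x v = dataNode (dataOf x) v := rfl

/-- The bit of the clock at a given time, with the bit `1` at time `0` and `0` after time `T`. -/
def timeBit (c : Fin T → Fin 2) (t : ℕ) : ℕ :=
  if t = 0 then 1 else if h : t - 1 < T then (c ⟨t - 1, h⟩).val else 0

theorem clockBit_eq (x : Config (siteDim n T)) (t : ℕ) :
    clockBit x t = timeBit (clockOf x) t := rfl

/-- The counting gate at the node `v + 1`. -/
def countData (v : Fin (n - 1)) (d : TreeData n) : TreeData n :=
  (d.1, Function.update d.2 v (countStep (v.val = 0) (dataNode d (2 * (v.val + 1)))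
    (dataNode d (2 * (v.val + 1) + 1)) (d.2 v)))

theorem countMap_eq (v : Fin (n - 1)) (x : Config (siteDim n T)) :
    countMap v x = joinConf (countData v (dataOf x)) (clockOf x) := by
  funext i
  rcases i with i | w | s
  · exact Function.update_of_ne (by simp) _ _
  · change _ = (countData v (dataOf x)).2 w
    by_cases hw : w = v
    · subst hw
      exact (Function.update_self _ _ _).trans
        (Function.update_self (β := fun _ => Fin 3) w _ (dataOf x).2).symm
    · exact (Function.update_of_ne (by simpa using hw) _ _).trans
        (Function.update_of_ne (β := fun _ => Fin 3) hw _ (dataOf x).2).symm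
  · exact Function.update_of_ne (by simp) _ _

/-- For fixed children, the gate is one of the permutations `z`, `z + 1`, `2 - z` of `ℤ/3`. -/
theorem countStep_injective (p : Prop) [Decidable p] (l r : ℕ) :
    Function.Injective (countStep p l r) := by
  intro z w h
  unfold countStep at h
  split_ifs at h <;> revert z w <;> decide

/-- A gate alters its own qutrit only, so the children that control it read the same before and
after. This makes the gate invertible and its inverse local. -/
theorem dataNode_congr {d d' : TreeData n} (v : Fin (n - 1)) (h1 : d.1 = d'.1)
    (h2 : ∀ w, w ≠ v → d.2 w = d'.2 w) {m : ℕ} (hm : m ≠ v.val + 1) :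
    dataNode d m = dataNode d' m := by
  unfold dataNode
  split_ifs with h h'
  · rw [h2]
    intro hv
    apply hm
    rw [← hv]
    simp only
    omega
  · rw [h1]
  · rfl

theorem countData_injective (v : Fin (n - 1)) : Function.Injective (countData v) := by
  intro d d' h
  have h1 : d.1 = d'.1 := (Prod.ext_iff.1 h).1
  have h2 := (Prod.ext_iff.1 h).2
  simp only [countData] at h2
  have h3 : ∀ w, w ≠ v → d.2 w = d'.2 w := fun w hw => by
    simpa [hw] using congrFun h2 w
  have h4 := congrFun h2 v
  rw [Function.update_self, Function.update_self,
    dataNode_congr v h1 h3 (by omega), dataNode_congr (d := d) v h1 h3 (by omega)] at h4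
  have h5 := countStep_injective _ _ _ h4
  refine Prod.ext h1 (funext fun w => ?_)
  by_cases hw : w = v
  · rw [hw, h5]
  · exact h3 w hw

/-- The counting gate as a permutation. -/
noncomputable def countPerm (v : Fin (n - 1)) : Equiv.Perm (TreeData n) :=
  Equiv.ofBijective (countData v) (Finite.injective_iff_bijective.1 (countData_injective v))

@[simp] theorem countPerm_apply (v : Fin (n - 1)) (d : TreeData n) :
    countPerm v d = countData v d := rfl

variable (n) in
/-- The `t`-th gate of the circuit as a permutation. -/
noncomputable def gatePerm (t : ℕ) : Equiv.Perm (TreeData n) :=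
  if h : 1 ≤ t ∧ t < n then countPerm ⟨n - t - 1, by omega⟩
  else if h : n ≤ t ∧ t + 3 ≤ 2 * n then (countPerm ⟨t + 1 - n, by omega⟩).symm
  else 1

theorem treeGate_apply (t : ℕ) (y x : Config (siteDim n T)) :
    treeGate n T t y x = if y = joinConf (gatePerm n t (dataOf x)) (clockOf x) then 1 else 0 := by
  unfold treeGate gatePerm
  by_cases h1 : 1 ≤ t ∧ t < n
  · rw [dif_pos h1, dif_pos h1, countGate, countMap_eq]
    rfl
  · rw [dif_neg h1, dif_neg h1]
    by_cases h2 : n ≤ t ∧ t + 3 ≤ 2 * n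
    · rw [dif_pos h2, dif_pos h2, Matrix.conjTranspose_apply, countGate]
      simp only [countMap_eq, eq_joinConf_iff, Equiv.eq_symm_apply, countPerm_apply]
      by_cases h3 : dataOf x = countData ⟨t + 1 - n, by omega⟩ (dataOf y) ∧ clockOf x = clockOf y
      · rw [if_pos h3, if_pos ⟨h3.1.symm, h3.2.symm⟩, star_one]
      · rw [if_neg h3, if_neg (fun h => h3 ⟨h.1.symm, h.2.symm⟩), star_zero]
    · rw [dif_neg h2, dif_neg h2, Matrix.one_apply]
      congr 1
      simp only [eq_joinConf_iff, Equiv.Perm.coe_one, id_eq, eq_iff_iff]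
      exact ⟨by rintro rfl; exact ⟨rfl, rfl⟩, fun h => conf_ext h.1 h.2⟩

/-- The basis state reached from `x` by the clock transition `s → s + 1`. -/
noncomputable def stepConf (s : Fin T) (x : Config (siteDim n T)) : Config (siteDim n T) :=
  joinConf (gatePerm n (s.val + 1) (dataOf x)) (Function.update (clockOf x) s 1)

/-- The clock is about to make the transition `s → s + 1`. -/
def BeforeStep (s : Fin T) (x : Config (siteDim n T)) : Prop :=
  clockBit x s.val = 1 ∧ clockBit x (s.val + 1) = 0 ∧ clockBit x (s.val + 2) = 0

instance (s : Fin T) (x : Config (siteDim n T)) : Decidable (BeforeStep s x) :=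
  inferInstanceAs (Decidable (_ ∧ _ ∧ _))

/-- The clock has just made the transition `s → s + 1`. -/
def AfterStep (s : Fin T) (x : Config (siteDim n T)) : Prop :=
  clockBit x s.val = 1 ∧ clockBit x (s.val + 1) = 1 ∧ clockBit x (s.val + 2) = 0

instance (s : Fin T) (x : Config (siteDim n T)) : Decidable (AfterStep s x) :=
  inferInstanceAs (Decidable (_ ∧ _ ∧ _))

/-- The transition `s → s + 1` of the clock together with its gate. -/
noncomputable def stepOp (s : Fin T) : Op (siteDim n T) :=
  treeGate n T (s.val + 1) * clockStep s

theorem stepOp_apply (s : Fin T) (y x : Config (siteDim n T)) :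
    stepOp s y x =
      if BeforeStep s x ∧ y = stepConf s x then 1 else 0 := by
  have hupd : Function.update x (Sum.inr (Sum.inr s)) (1 : Fin 2) =
      joinConf (dataOf x) (Function.update (clockOf x) s 1) := by
    funext i
    rcases i with i | w | r
    · exact Function.update_of_ne (by simp) _ _
    · exact Function.update_of_ne (by simp) _ _
    · change _ = Function.update (clockOf x) s 1 r
      by_cases hr : r = s
      · subst hr
        exact (Function.update_self _ _ _).trans
          (Function.update_self (β := fun _ => Fin 2) r _ (clockOf x)).symm
      · exact (Function.update_of_ne (by simpa using hr) _ _).trans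
          (Function.update_of_ne (β := fun _ => Fin 2) hr _ (clockOf x)).symm
  rw [stepOp, Matrix.mul_apply,
    Finset.sum_eq_single (joinConf (dataOf x) (Function.update (clockOf x) s 1))]
  · rw [treeGate_apply, clockStep, hupd]
    simp only [dataOf_joinConf, clockOf_joinConf, and_true]
    change (if y = stepConf s x then 1 else 0) * (if BeforeStep s x then (1 : ℂ) else 0) = _
    split_ifs <;> simp_all
  · intro z _ hz
    rw [clockStep, hupd, if_neg (fun h => hz h.2), mul_zero]
  · simp

theorem timeBit_succ (c : Fin T → Fin 2) (s : Fin T) : timeBit c (s.val + 1) = (c s).val := by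
  simp [timeBit]

theorem timeBit_update (c : Fin T → Fin 2) (s : Fin T) (a : Fin 2) {t : ℕ} (ht : t ≠ s.val + 1) :
    timeBit (Function.update c s a) t = timeBit c t := by
  unfold timeBit
  split_ifs with h1 h2
  · rfl
  · rw [Function.update_of_ne]
    intro h
    apply ht
    rw [← h]
    simp only
    omega
  · rfl

theorem afterStep_stepConf {s : Fin T} {x : Config (siteDim n T)} (hx : BeforeStep s x) :
    AfterStep s (stepConf s x) := by
  obtain ⟨h1, h2, h3⟩ := hx
  simp only [clockBit_eq] at h1 h2 h3
  refine ⟨?_, ?_, ?_⟩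
  · rw [clockBit_eq, stepConf, clockOf_joinConf, timeBit_update _ _ _ (by omega), h1]
  · rw [clockBit_eq, stepConf, clockOf_joinConf, timeBit_succ, Function.update_self]
    rfl
  · rw [clockBit_eq, stepConf, clockOf_joinConf, timeBit_update _ _ _ (by omega), h3]

/-- The step overwrites clock bit `s + 1`, but that bit was known to be `0`, so no information is
lost. -/
theorem stepConf_injOn {s : Fin T} {x x' : Config (siteDim n T)} (hx : BeforeStep s x)
    (hx' : BeforeStep s x') (h : stepConf s x = stepConf s x') : x = x' := by
  have hd := congrArg dataOf h
  have hc := congrArg clockOf h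
  simp only [stepConf, dataOf_joinConf, clockOf_joinConf] at hd hc
  refine conf_ext ((gatePerm n (s.val + 1)).injective hd) (funext fun r => ?_)
  by_cases hr : r = s
  · subst hr
    have h1 := hx.2.1
    have h2 := hx'.2.1
    rw [clockBit_eq, timeBit_succ] at h1 h2
    exact Fin.ext (h1.trans h2.symm)
  · simpa [hr] using congrFun hc r

theorem exists_stepConf_eq {s : Fin T} {y : Config (siteDim n T)} (hy : AfterStep s y) :
    ∃ x, BeforeStep s x ∧ stepConf s x = y := by
  obtain ⟨h1, h2, h3⟩ := hy
  simp only [clockBit_eq] at h1 h2 h3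
  refine ⟨joinConf ((gatePerm n (s.val + 1)).symm (dataOf y)) (Function.update (clockOf y) s 0),
    ⟨?_, ?_, ?_⟩, ?_⟩
  · rw [clockBit_eq, clockOf_joinConf, timeBit_update _ _ _ (by omega), h1]
  · rw [clockBit_eq, clockOf_joinConf, timeBit_succ, Function.update_self]
    rfl
  · rw [clockBit_eq, clockOf_joinConf, timeBit_update _ _ _ (by omega), h3]
  · refine conf_ext (by simp [stepConf]) ?_
    rw [stepConf, clockOf_joinConf, clockOf_joinConf, Function.update_idem]
    rw [timeBit_succ] at h2
    refine (Function.update_eq_self_iff).2 (Fin.ext ?_)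
    rw [h2]
    rfl

/-- The transition `s → s + 1` is a partial isometry. -/
theorem stepOp_mul_conjTranspose (s : Fin T) :
    (stepOp s : Op (siteDim n T)) * (stepOp s)ᴴ = basisProj (AfterStep s) := by
  ext y y'
  rw [Matrix.mul_apply, basisProj, Matrix.diagonal_apply]
  simp only [Matrix.conjTranspose_apply, stepOp_apply]
  by_cases hy : AfterStep s y
  · obtain ⟨x, hx, rfl⟩ := exists_stepConf_eq hy
    rw [Finset.sum_eq_single x]
    · by_cases hyy : stepConf s x = y'
      · subst hyy
        simp [hx, hy]
      · simp [hyy, Ne.symm hyy]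
    · intro z _ hz
      rw [if_neg, zero_mul]
      rintro ⟨hz1, hz2⟩
      exact hz (stepConf_injOn hz1 hx hz2.symm)
    · simp
  · rw [Finset.sum_eq_zero]
    · simp [hy]
    · intro x _
      rw [if_neg, zero_mul]
      rintro ⟨hx, rfl⟩
      exact hy (afterStep_stepConf hx)

/-- The difference operator of the transition `s → s + 1`. -/
noncomputable def stepDiff (s : Fin T) : Op (siteDim n T) :=
  (stepOp s)ᴴ - basisProj (BeforeStep s)

theorem stepDiff_mulVec (s : Fin T) (ψ : Config (siteDim n T) → ℂ) (x : Config (siteDim n T)) :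
    (stepDiff s *ᵥ ψ) x = if BeforeStep s x then ψ (stepConf s x) - ψ x else 0 := by
  rw [stepDiff, Matrix.sub_mulVec, Pi.sub_apply, basisProj, Matrix.mulVec_diagonal]
  simp only [Matrix.mulVec, dotProduct, Matrix.conjTranspose_apply, stepOp_apply]
  by_cases hx : BeforeStep s x
  · rw [Finset.sum_eq_single (stepConf s x)] <;> simp +contextual [hx]
  · simp [hx]

/-- With `W` the transition and `B` its initial projector, `W * B = W` and `W * Wᴴ` is the final
projector; expand `(W - B) * (Wᴴ - B)`. The energy of a step thus becomes a sum of squared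
differences of amplitudes. -/
theorem hPropTerm_eq (s : Fin T) :
    (hPropTerm s : Op (siteDim n T)) = (stepDiff s)ᴴ * stepDiff s := by
  set W : Op (siteDim n T) := stepOp s with hW
  set B : Op (siteDim n T) := basisProj (BeforeStep s) with hB
  have hBB : B * B = B := by
    rw [hB, basisProj, Matrix.diagonal_mul_diagonal]
    congr 1
    funext x
    simp
  have hBH : Bᴴ = B := by
    rw [hB, basisProj, Matrix.diagonal_conjTranspose]
    congr 1
    funext x
    simp only [Pi.star_apply]
    split_ifs <;> simp
  have hWB : W * B = W := by
    ext y x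
    rw [hB, basisProj, Matrix.mul_diagonal, hW, stepOp_apply]
    by_cases hx : BeforeStep s x <;> simp [hx]
  have hBW : B * Wᴴ = Wᴴ := by
    have := congrArg Matrix.conjTranspose hWB
    rwa [Matrix.conjTranspose_mul, hBH] at this
  have hdef : (hPropTerm s : Op (siteDim n T)) = B + basisProj (AfterStep s) - W - Wᴴ := rfl
  rw [hdef, stepDiff, ← hW, ← hB, Matrix.conjTranspose_sub, Matrix.conjTranspose_conjTranspose,
    hBH, Matrix.sub_mul, Matrix.mul_sub, Matrix.mul_sub, hBB, hBW, hWB, hW, stepOp_mul_conjTranspose]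
  abel

end Gates

/-! ### Histories of the circuit -/

section Histories

variable {n T : ℕ}

variable (n) in
/-- The first `t` gates of the circuit. -/
noncomputable def circuit : ℕ → Equiv.Perm (TreeData n)
  | 0 => 1
  | t + 1 => gatePerm n (t + 1) * circuit t

variable (T) in
/-- The clock state of time `t`. -/
def clockState (t : ℕ) : Fin T → Fin 2 := fun j => if j.val < t then 1 else 0

variable (T) in
/-- The computation on the input `d` at time `t`. -/
noncomputable def history (d : TreeData n) (t : ℕ) : Config (siteDim n T) :=
  joinConf (circuit n t d) (clockState T t)

theorem timeBit_clockState {t : ℕ} (ht : t ≤ T) (r : ℕ) :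
    timeBit (clockState T t) r = if r ≤ t then 1 else 0 := by
  unfold timeBit clockState
  split_ifs with h1 h2 h3 h4 h5 h6 h7
  all_goals first
    | rfl
    | (exfalso; omega)
    | skip
  all_goals simp only at *
  all_goals exfalso; omega

theorem clockBit_history {t : ℕ} (ht : t ≤ T) (d : TreeData n) (r : ℕ) :
    clockBit (history T d t) r = if r ≤ t then 1 else 0 :=
  timeBit_clockState ht r

theorem clockState_inj {t t' : ℕ} (ht : t ≤ T) (ht' : t' ≤ T)
    (h : clockState T t = clockState T t') : t = t' := by
  have h1 := timeBit_clockState ht t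
  have h2 := timeBit_clockState ht' t
  have h3 := timeBit_clockState ht t'
  have h4 := timeBit_clockState ht' t'
  rw [h] at h1 h3
  rw [h1] at h2
  rw [h3] at h4
  split_ifs at h2 h4 <;> omega

theorem history_inj (d d' : TreeData n) (t t' : ℕ) (ht : t ≤ T) (ht' : t' ≤ T)
    (h : history T d t = history T d' t') : d = d' ∧ t = t' := by
  obtain rfl := clockState_inj ht ht' (congrArg clockOf h)
  exact ⟨(circuit n t).injective (congrArg dataOf h), rfl⟩

theorem beforeStep_history (s : Fin T) (d : TreeData n) : BeforeStep s (history T d s.val) := by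
  unfold BeforeStep
  rw [clockBit_history s.2.le, clockBit_history s.2.le, clockBit_history s.2.le]
  simp

theorem stepConf_history (s : Fin T) (d : TreeData n) :
    stepConf s (history T d s.val) = history T d (s.val + 1) := by
  refine conf_ext rfl (funext fun r => ?_)
  simp only [stepConf, history, clockOf_joinConf, clockState]
  by_cases hr : r = s
  · subst hr
    rw [Function.update_self, if_pos (Nat.lt_succ_self _)]
  · have : r.val ≠ s.val := fun h => hr (Fin.ext h)
    rw [Function.update_of_ne hr]
    change (if r.val < s.val then (1 : Fin 2) else 0) = if r.val < s.val + 1 then 1 else 0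
    split_ifs <;> first | rfl | omega

/-- Without a pattern `01`, ones propagate downwards, so the clock is determined by the position of
its last `1`. -/
theorem exists_clockState_eq (c : Fin T → Fin 2)
    (h : ∀ t, 1 ≤ t → t < T → ¬ (timeBit c t = 0 ∧ timeBit c (t + 1) = 1)) :
    ∃ t ≤ T, c = clockState T t := by
  have hbit : ∀ t, timeBit c t = 0 ∨ timeBit c t = 1 := by
    intro t
    unfold timeBit
    split_ifs
    · simp
    · omega
    · simp
  have hdown : ∀ r k, r + k ≤ T → timeBit c (r + k) = 1 → timeBit c r = 1 := by
    intro r k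
    induction k with
    | zero => exact fun _ h => h
    | succ k ih =>
      intro hk h1
      apply ih (by omega)
      rcases Nat.eq_zero_or_pos (r + k) with h0 | h0
      · rw [h0]
        rfl
      · rcases hbit (r + k) with h2 | h2
        · exact (h (r + k) h0 (by omega) ⟨h2, h1⟩).elim
        · exact h2
  -- The formal bit `1` at time `0` guarantees that some position qualifies, even on an all-zero
  -- clock.
  set t := Nat.findGreatest (fun t => timeBit c t = 1) T with ht
  have htT : t ≤ T := Nat.findGreatest_le T
  have ht1 : timeBit c t = 1 :=
    Nat.findGreatest_spec (P := fun t => timeBit c t = 1) (Nat.zero_le T) rfl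
  refine ⟨t, htT, funext fun j => ?_⟩
  have hj := timeBit_succ c j
  unfold clockState
  split_ifs with hlt
  · have := hdown (j.val + 1) (t - (j.val + 1)) (by omega)
      (by rwa [Nat.add_sub_cancel' (by omega)])
    rw [this] at hj
    exact Fin.ext hj.symm
  · have : ¬ timeBit c (j.val + 1) = 1 :=
      Nat.findGreatest_is_greatest (P := fun t => timeBit c t = 1) (n := T) (by omega) (by omega)
    rcases hbit (j.val + 1) with h2 | h2
    · rw [h2] at hj
      exact Fin.ext hj.symm
    · exact (this h2).elim

/-- Running the invertible circuit backwards from the clock time recovers the input, so the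
histories cover all legal clock states. -/
theorem exists_history_eq (x : Config (siteDim n T))
    (h : ∀ t, 1 ≤ t → t < T → ¬ (clockBit x t = 0 ∧ clockBit x (t + 1) = 1)) :
    ∃ d t, t ≤ T ∧ history T d t = x := by
  obtain ⟨t, ht, hc⟩ := exists_clockState_eq (clockOf x) h
  exact ⟨(circuit n t).symm (dataOf x), t, ht, conf_ext (by simp [history]) (by simp [history, hc])⟩

/-- Either equation forces the clock time `t = s`; the rest is injectivity of the step. -/
theorem stepConf_eq_history_iff (s : Fin T) {x : Config (siteDim n T)} (hx : BeforeStep s x)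
    (d : TreeData n) {t : ℕ} (ht : t < T) :
    stepConf s x = history T d (t + 1) ↔ x = history T d t := by
  have key : t = s.val → (stepConf s x = history T d (t + 1) ↔ x = history T d t) := by
    rintro rfl
    rw [← stepConf_history]
    exact ⟨stepConf_injOn hx (beforeStep_history s d), congrArg _⟩
  constructor
  · intro h
    refine (key ?_).1 h
    have ha := afterStep_stepConf hx
    rw [h] at ha
    obtain ⟨-, h2, h3⟩ := ha
    rw [clockBit_history (by omega)] at h2 h3
    split_ifs at h2 h3
    omega
  · intro h
    refine (key ?_).2 h
    rw [h] at hx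
    obtain ⟨h1, h2, -⟩ := hx
    rw [clockBit_history (by omega)] at h1 h2
    split_ifs at h1 h2
    omega

/-- The uniform superposition of a history is annihilated by the propagation terms. -/
theorem sum_history_stepConf (s : Fin T) {x : Config (siteDim n T)} (hx : BeforeStep s x)
    (d : TreeData n) :
    (∑ t ∈ Finset.range (T + 1), if stepConf s x = history T d t then (1 : ℂ) else 0) =
      ∑ t ∈ Finset.range (T + 1), if x = history T d t then (1 : ℂ) else 0 := by
  -- Dropping `t = 0` on the left and `t = T` on the right aligns the sums. The dropped terms
  -- vanish: a state after a step is not at time `0`, and a state before a step is not at time `T`.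
  rw [Finset.sum_range_succ', Finset.sum_range_succ]
  congr 1
  · refine Finset.sum_congr rfl fun t ht => ?_
    simp only [stepConf_eq_history_iff s hx d (Finset.mem_range.1 ht)]
  · rw [if_neg, if_neg]
    · rintro rfl
      have := hx.2.1
      rw [clockBit_history le_rfl] at this
      simp at this
    · intro h
      have := (afterStep_stepConf hx).2.1
      rw [h, clockBit_history (Nat.zero_le T)] at this
      simp at this

end Histories

/-! ### The outcome of the tree counting circuit -/

section Counting

variable {n : ℕ}

/-- The state of the node `v` after its counting gate, when all ancillas start in the state `0`. -/
def countValue (q : Fin n → Fin 2) (v : ℕ) : ℕ :=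
  if _h : 1 ≤ v ∧ v < n then
    (countStep (v = 1) (countValue q (2 * v)) (countValue q (2 * v + 1)) 0).val
  else if h : n ≤ v ∧ v < 2 * n then (q ⟨v - n, by omega⟩).val
  else 0
termination_by 2 * n - v

/-- The number of excitations in the subtree at the node `v`. -/
def subtreeWeight (q : Fin n → Fin 2) (v : ℕ) : ℕ :=
  if _h : 1 ≤ v ∧ v < n then subtreeWeight q (2 * v) + subtreeWeight q (2 * v + 1)
  else if h : n ≤ v ∧ v < 2 * n then (q ⟨v - n, by omega⟩).val
  else 0
termination_by 2 * n - v

/-- Qubits and qutrits after `t` gates, when all ancillas start in the state `0`. -/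
def countState (q : Fin n → Fin 2) (t : ℕ) : TreeData n :=
  -- Node `m = v + 1` is counted at time `n - m` and uncounted at time `m + n - 2`; the condition
  -- describes the window in between, which never closes for the root.
  (q, fun v => if n ≤ t + (v.val + 1) ∧ (v.val = 0 ∨ t + 2 < (v.val + 1) + n) then
    countStep (v.val = 0) (countValue q (2 * (v.val + 1))) (countValue q (2 * (v.val + 1) + 1)) 0
    else 0)

theorem dataNode_countState (q : Fin n → Fin 2) {t m : ℕ} (h1 : n ≤ t + m) (h2 : t + 2 < m + n)
    (h3 : 1 < m) : dataNode (countState q t) m = countValue q m := by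
  rw [dataNode, countValue]
  split_ifs with h h'
  · have hm : m - 1 + 1 = m := by omega
    have hm1 : (m - 1 = 0) ↔ (m = 1) := by omega
    simp only [countState, hm, hm1]
    rw [if_pos ⟨h1, Or.inr h2⟩]
  · rfl
  · rfl

/-- Children have larger numbers than their parent, so they are leaves or already counted when the
parent's gate acts. -/
theorem countData_countState_compute (q : Fin n → Fin 2) {t : ℕ} (ht : t + 1 < n) :
    countData ⟨n - (t + 1) - 1, by omega⟩ (countState q t) = countState q (t + 1) := by
  refine Prod.ext rfl (funext fun w => ?_)
  unfold countData
  dsimp only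
  by_cases hw : w = ⟨n - (t + 1) - 1, by omega⟩
  · subst hw
    rw [Function.update_self, dataNode_countState, dataNode_countState]
    · simp only [countState]
      rw [if_neg (by omega), if_pos (by omega)]
    all_goals omega
  · have hne : w.val ≠ n - (t + 1) - 1 := fun h => hw (Fin.ext h)
    rw [Function.update_of_ne hw]
    simp only [countState]
    have : (n ≤ t + (w.val + 1) ∧ (w.val = 0 ∨ t + 2 < (w.val + 1) + n)) ↔
      (n ≤ t + 1 + (w.val + 1) ∧ (w.val = 0 ∨ t + 1 + 2 < (w.val + 1) + n)) := by omega
    simp only [this]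

/-- Read backwards in time, uncounting is a counting gate. Nodes are uncounted in increasing order,
so the children still hold their counts. -/
theorem countData_countState_uncompute (q : Fin n → Fin 2) {t : ℕ} (ht : n ≤ t + 1)
    (ht' : t + 1 + 3 ≤ 2 * n) :
    countData ⟨t + 1 + 1 - n, by omega⟩ (countState q (t + 1)) = countState q t := by
  refine Prod.ext rfl (funext fun w => ?_)
  unfold countData
  dsimp only
  by_cases hw : w = ⟨t + 1 + 1 - n, by omega⟩
  · subst hw
    rw [Function.update_self, dataNode_countState, dataNode_countState]
    · simp only [countState]
      rw [if_neg (by omega), if_pos (by omega)]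
    all_goals omega
  · have hne : w.val ≠ t + 1 + 1 - n := fun h => hw (Fin.ext h)
    rw [Function.update_of_ne hw]
    simp only [countState]
    have : (n ≤ t + (w.val + 1) ∧ (w.val = 0 ∨ t + 2 < (w.val + 1) + n)) ↔
      (n ≤ t + 1 + (w.val + 1) ∧ (w.val = 0 ∨ t + 1 + 2 < (w.val + 1) + n)) := by omega
    simp only [this]

theorem gatePerm_countState (q : Fin n → Fin 2) (t : ℕ) :
    gatePerm n (t + 1) (countState q t) = countState q (t + 1) := by
  unfold gatePerm
  split_ifs with h1 h2
  · exact countData_countState_compute q h1.2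
  · rw [Equiv.symm_apply_eq]
    exact (countData_countState_uncompute q h2.1 h2.2).symm
  · refine Prod.ext rfl (funext fun w => ?_)
    have hw := w.2
    simp only [Equiv.Perm.coe_one, id_eq, countState]
    have : (n ≤ t + (w.val + 1) ∧ (w.val = 0 ∨ t + 2 < (w.val + 1) + n)) ↔
      (n ≤ t + 1 + (w.val + 1) ∧ (w.val = 0 ∨ t + 1 + 2 < (w.val + 1) + n)) := by omega
    simp only [this]

theorem circuit_zero_ancilla (q : Fin n → Fin 2) (t : ℕ) :
    circuit n t (q, 0) = countState q t := by
  induction t with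
  | zero =>
    refine Prod.ext rfl (funext fun w => ?_)
    have hw := w.2
    simp only [circuit, Equiv.Perm.coe_one, id_eq, countState]
    rw [if_neg (by omega)]
    rfl
  | succ t ih => rw [circuit, Equiv.Perm.mul_apply, ih, gatePerm_countState]

/-- A nonroot gate applied to `0` is addition saturated at `2`. The root is excluded because its
gate records only a threshold. The induction runs from the leaves towards the root. -/
theorem countValue_eq_min (q : Fin n → Fin 2) (v : ℕ) (hv : 2 ≤ v) :
    countValue q v = min 2 (subtreeWeight q v) := by
  induction h : 2 * n - v using Nat.strong_induction_on generalizing v with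
  | _ k ih =>
    rw [countValue, subtreeWeight]
    split_ifs with h1 h2
    · rw [ih (2 * n - 2 * v) (by omega) (2 * v) (by omega) rfl,
        ih (2 * n - (2 * v + 1)) (by omega) (2 * v + 1) (by omega) rfl]
      generalize subtreeWeight q (2 * v) = a
      generalize subtreeWeight q (2 * v + 1) = b
      unfold countStep
      split_ifs with h3 h4 h5 h6
      · omega
      · omega
      · rw [show min 2 (a + b) = 0 by omega]; rfl
      · rw [show min 2 (a + b) = 1 by omega]; rfl
      · rw [show min 2 (a + b) = 2 by omega]; rfl
    · omega
    · rfl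

/-- Passing from `k` to `k + 1` replaces node `k` by its children `2k` and `2k + 1`, which preserves
the sum. At `k = n` the interval consists of the leaves. -/
theorem sum_subtreeWeight (q : Fin n → Fin 2) (k : ℕ) (hk : 1 ≤ k) (hkn : k ≤ n) :
    ∑ v ∈ Finset.Ico k (2 * k), subtreeWeight q v = subtreeWeight q 1 := by
  induction k, hk using Nat.le_induction with
  | base => simp
  | succ k hk ih =>
    have h := ih (by omega)
    rw [Finset.sum_eq_sum_Ico_succ_bot (by omega), subtreeWeight, dif_pos (by omega)] at h
    rw [show 2 * (k + 1) = 2 * k + 1 + 1 by ring, Finset.sum_Ico_succ_top (by omega),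
      Finset.sum_Ico_succ_top (by omega)]
    omega

theorem subtreeWeight_one (q : Fin n → Fin 2) (hn : 1 ≤ n) :
    subtreeWeight q 1 = ∑ i, (q i).val := by
  rw [← sum_subtreeWeight q n hn le_rfl, Finset.sum_Ico_eq_sum_range, show 2 * n - n = n by omega,
    Finset.sum_range]
  refine Finset.sum_congr rfl fun i _ => ?_
  rw [subtreeWeight, dif_neg (by omega), dif_pos (by omega)]
  simp

theorem rootStep_eq_zero_iff (q : Fin n → Fin 2) (hn : 2 ≤ n) (p : Prop) [Decidable p] (hp : p) :
    countStep p (countValue q 2) (countValue q 3) 0 = 0 ↔ ∑ i, (q i).val ≤ 1 := by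
  rw [← subtreeWeight_one q (by omega), subtreeWeight, dif_pos (by omega),
    countValue_eq_min q 2 le_rfl, countValue_eq_min q 3 (by omega)]
  norm_num only
  generalize subtreeWeight q 2 = a
  generalize subtreeWeight q 3 = b
  unfold countStep
  rw [if_pos hp]
  split_ifs with h
  · simp only [true_iff]
    omega
  · constructor
    · intro h1
      simp at h1
    · intro h1
      omega

variable {T : ℕ}

/-- The inputs whose computations have energy zero. -/
def IsGoodInput (d : TreeData n) : Prop := d.2 = 0 ∧ ∑ i, (d.1 i).val ≤ 1

instance : DecidablePred (IsGoodInput (n := n)) := fun _ => inferInstanceAs (Decidable (_ ∧ _))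

theorem IsGoodInput.circuit_eq {d : TreeData n} (hd : IsGoodInput d) (t : ℕ) :
    circuit n t d = countState d.1 t := by
  rw [← circuit_zero_ancilla, ← hd.1]

/-- After the circuit, the ancillas of a good input are back in the state `0`. -/
theorem IsGoodInput.circuit_of_le {d : TreeData n} (hd : IsGoodInput d) (hn : 2 ≤ n) {t : ℕ}
    (ht : 2 * n - 3 ≤ t) : circuit n t d = d := by
  rw [hd.circuit_eq]
  refine Prod.ext rfl (funext fun v => ?_)
  have hv := v.2
  rw [hd.1]
  simp only [countState, Pi.zero_apply]
  split_ifs with h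
  · have h0 : v.val = 0 := by omega
    rw [h0]
    exact (rootStep_eq_zero_iff d.1 hn _ rfl).2 hd.2
  · rfl

theorem dataNode_internal (d : TreeData n) (v : Fin (n - 1)) :
    dataNode d (v.val + 1) = (d.2 v).val := by
  rw [dataNode, dif_pos (by omega)]
  rfl

theorem dataNode_root (hn : 2 ≤ n) (d : TreeData n) :
    dataNode d 1 = (d.2 ⟨0, by omega⟩).val :=
  dataNode_internal d ⟨0, by omega⟩

theorem IsGoodInput.node_eq_zero {d : TreeData n} (hd : IsGoodInput d) (v : Fin (n - 1)) {t : ℕ}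
    (ht : t < n - (v.val + 1)) : nodeState (history T d t) (v.val + 1) = 0 := by
  rw [nodeState_eq, history, dataOf_joinConf, hd.circuit_eq, dataNode_internal]
  simp only [countState]
  rw [if_neg (by omega)]
  rfl

theorem IsGoodInput.root_eq_zero {d : TreeData n} (hd : IsGoodInput d) (hn : 2 ≤ n) (t : ℕ) :
    nodeState (history T d t) 1 = 0 := by
  rw [nodeState_eq, history, dataOf_joinConf, hd.circuit_eq, dataNode_root hn]
  simp only [countState]
  split_ifs with h
  · exact congrArg Fin.val ((rootStep_eq_zero_iff d.1 hn ((0 : ℕ) = 0) rfl).2 hd.2)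
  · rfl

/-- The root qutrit is excited right after its gate if the input has two excitations. -/
theorem root_ne_zero {d : TreeData n} (h0 : d.2 = 0) (hd : ¬ ∑ i, (d.1 i).val ≤ 1) (hn : 2 ≤ n) :
    nodeState (history T d (n - 1)) 1 ≠ 0 := by
  have hdd : d = (d.1, 0) := Prod.ext rfl h0
  rw [nodeState_eq, history, dataOf_joinConf, hdd, circuit_zero_ancilla,
    dataNode_root hn]
  dsimp only [countState]
  rw [if_pos ⟨by omega, Or.inl rfl⟩]
  intro h
  exact hd ((rootStep_eq_zero_iff d.1 hn ((0 : ℕ) = 0) rfl).1 (Fin.ext h))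

end Counting

/-! ### Spectrum of the circuit Hamiltonian -/

section CircuitGap

variable {n T : ℕ}

/-- The number of violated clock, input and output constraints. -/
noncomputable def penalty (x : Config (siteDim n T)) : ℝ :=
  ∑ t ∈ Finset.Ico 1 T, (if clockBit x t = 0 ∧ clockBit x (t + 1) = 1 then 1 else 0)
    + ∑ v : Fin (n - 1),
      (if nodeState x (v.val + 1) ≠ 0 ∧ clockBit x (n - (v.val + 1)) = 0 then 1 else 0)
    + if nodeState x 1 ≠ 0 ∧ clockBit x (n - 1) = 1 then 1 else 0

theorem sum_diagonal {m κ : Type} [DecidableEq m] (s : Finset κ) (f : κ → m → ℂ) :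
    ∑ k ∈ s, Matrix.diagonal (f k) = Matrix.diagonal (fun x => ∑ k ∈ s, f k x) := by
  ext i j
  rw [Matrix.sum_apply]
  by_cases hij : i = j
  · subst hij
    simp
  · simp [hij]

/-- The form needed for `sum_paths_le`: a Laplacian plus a diagonal potential. -/
theorem treeCircuitHamiltonian_eq (J : ℝ) :
    treeCircuitHamiltonian n T J J J J =
      (J : ℂ) • ∑ s : Fin T, (stepDiff s)ᴴ * stepDiff s +
        Matrix.diagonal (fun x => ((J * penalty x : ℝ) : ℂ)) := by
  have hsplit : Matrix.diagonal (fun x : Config (siteDim n T) => ((J * penalty x : ℝ) : ℂ)) =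
      (J : ℂ) • hClock n T + (J : ℂ) • hIn n T + (J : ℂ) • hOut n T := by
    unfold hClock hIn hOut basisProj
    rw [sum_diagonal, sum_diagonal, ← Matrix.diagonal_smul, ← Matrix.diagonal_smul,
      ← Matrix.diagonal_smul, Matrix.diagonal_add, Matrix.diagonal_add]
    congr 1
    funext x
    unfold penalty
    simp only [Pi.smul_apply, smul_eq_mul, Complex.ofReal_mul, Complex.ofReal_add,
      Complex.ofReal_sum, apply_ite Complex.ofReal, Complex.ofReal_one, Complex.ofReal_zero]
    ring
  have hprop : hProp n T = ∑ s : Fin T, (stepDiff s)ᴴ * stepDiff s :=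
    Finset.sum_congr rfl fun s _ => hPropTerm_eq s
  rw [hsplit, ← hprop, treeCircuitHamiltonian]
  abel

theorem treeCircuitHamiltonian_isHermitian (J : ℝ) :
    (treeCircuitHamiltonian n T J J J J).IsHermitian := by
  rw [treeCircuitHamiltonian_eq, Matrix.IsHermitian, Matrix.conjTranspose_add,
    Matrix.conjTranspose_smul, Matrix.conjTranspose_sum, Matrix.diagonal_conjTranspose]
  congr 1
  · congr 1
    · simp
    · refine Finset.sum_congr rfl fun s _ => ?_
      rw [Matrix.conjTranspose_mul, Matrix.conjTranspose_conjTranspose]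
  · congr 1
    funext x
    simp

theorem form_treeCircuitHamiltonian (J : ℝ) (ψ : Config (siteDim n T) → ℂ) :
    star ψ ⬝ᵥ (treeCircuitHamiltonian n T J J J J *ᵥ ψ) =
      ((J * ∑ s : Fin T, ∑ x, ‖(stepDiff s *ᵥ ψ) x‖ ^ 2 +
        ∑ x, J * penalty x * ‖ψ x‖ ^ 2 : ℝ) : ℂ) := by
  rw [treeCircuitHamiltonian_eq, Matrix.add_mulVec, dotProduct_add, form_diagonal,
    Matrix.smul_mulVec, dotProduct_smul, Matrix.sum_mulVec, dotProduct_sum]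
  simp only [form_conjTranspose_mul_self]
  push_cast
  rfl

theorem penalty_nonneg (x : Config (siteDim n T)) : 0 ≤ penalty x := by
  unfold penalty
  refine add_nonneg (add_nonneg (Finset.sum_nonneg fun _ _ => ?_)
    (Finset.sum_nonneg fun _ _ => ?_)) ?_ <;> split_ifs <;> norm_num

theorem one_le_penalty_of_clock {x : Config (siteDim n T)} {t : ℕ} (h1 : 1 ≤ t) (hT : t < T)
    (h : clockBit x t = 0 ∧ clockBit x (t + 1) = 1) : 1 ≤ penalty x := by
  have h2 := Finset.single_le_sum (s := Finset.Ico 1 T) (a := t)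
    (f := fun t => if clockBit x t = 0 ∧ clockBit x (t + 1) = 1 then (1 : ℝ) else 0)
    (fun _ _ => by split_ifs <;> norm_num) (by simp; omega)
  simp only [if_pos h] at h2
  unfold penalty
  have h3 : (0 : ℝ) ≤ ∑ v : Fin (n - 1),
    (if nodeState x (v.val + 1) ≠ 0 ∧ clockBit x (n - (v.val + 1)) = 0 then 1 else 0) :=
    Finset.sum_nonneg fun _ _ => by split_ifs <;> norm_num
  have h4 : (0 : ℝ) ≤ if nodeState x 1 ≠ 0 ∧ clockBit x (n - 1) = 1 then 1 else 0 := by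
    split_ifs <;> norm_num
  linarith

theorem one_le_penalty_of_input {x : Config (siteDim n T)} (v : Fin (n - 1))
    (h : nodeState x (v.val + 1) ≠ 0 ∧ clockBit x (n - (v.val + 1)) = 0) : 1 ≤ penalty x := by
  have h2 := Finset.single_le_sum (s := Finset.univ) (a := v)
    (f := fun v : Fin (n - 1) =>
      if nodeState x (v.val + 1) ≠ 0 ∧ clockBit x (n - (v.val + 1)) = 0 then (1 : ℝ) else 0)
    (fun _ _ => by split_ifs <;> norm_num) (Finset.mem_univ _)
  simp only [if_pos h] at h2
  unfold penalty
  have h3 : (0 : ℝ) ≤ ∑ t ∈ Finset.Ico 1 T,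
    (if clockBit x t = 0 ∧ clockBit x (t + 1) = 1 then 1 else 0) :=
    Finset.sum_nonneg fun _ _ => by split_ifs <;> norm_num
  have h4 : (0 : ℝ) ≤ if nodeState x 1 ≠ 0 ∧ clockBit x (n - 1) = 1 then 1 else 0 := by
    split_ifs <;> norm_num
  linarith

theorem one_le_penalty_of_output {x : Config (siteDim n T)}
    (h : nodeState x 1 ≠ 0 ∧ clockBit x (n - 1) = 1) : 1 ≤ penalty x := by
  unfold penalty
  rw [if_pos h]
  refine le_add_of_nonneg_left (add_nonneg (Finset.sum_nonneg fun _ _ => ?_)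
    (Finset.sum_nonneg fun _ _ => ?_)) <;> split_ifs <;> norm_num

theorem IsGoodInput.penalty_history {d : TreeData n} (hd : IsGoodInput d) (hn : 2 ≤ n) {t : ℕ}
    (ht : t ≤ T) : penalty (history T d t) = 0 := by
  unfold penalty
  rw [Finset.sum_eq_zero, Finset.sum_eq_zero, if_neg]
  · simp
  · simp [hd.root_eq_zero hn t]
  · intro v _
    rw [if_neg]
    rintro ⟨h1, h2⟩
    rw [clockBit_history ht] at h2
    refine h1 (hd.node_eq_zero v ?_)
    by_contra hcon
    rw [if_pos (by omega)] at h2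
    exact one_ne_zero h2
  · intro r _
    rw [if_neg]
    rw [clockBit_history ht, clockBit_history ht]
    split_ifs <;> simp
    omega

/-- A nonzero ancilla is caught at time `0`, before any gate; with clean ancillas, two or more
excitations are caught at the root at time `n - 1`. -/
theorem exists_penalty_of_not_good {d : TreeData n} (hd : ¬ IsGoodInput d) (hn : 2 ≤ n)
    (hT : n - 1 ≤ T) : ∃ t ≤ T, 1 ≤ penalty (history T d t) := by
  by_cases h0 : d.2 = 0
  · refine ⟨n - 1, hT, one_le_penalty_of_output ⟨root_ne_zero h0 (fun h => hd ⟨h0, h⟩) hn, ?_⟩⟩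
    rw [clockBit_history hT, if_pos le_rfl]
  · obtain ⟨v, hv⟩ := Function.ne_iff.1 h0
    refine ⟨0, Nat.zero_le _, one_le_penalty_of_input v ⟨?_, ?_⟩⟩
    · rw [nodeState_eq, history, dataOf_joinConf, dataNode_internal]
      exact fun h => hv (Fin.ext h)
    · rw [clockBit_history (Nat.zero_le _), if_neg (by omega)]

/-- The energy of a state bounds its norm up to its overlaps with the good histories. -/
theorem sum_norm_sq_le_energy (hn : 2 ≤ n) (hT : n - 1 ≤ T) {J : ℝ}
    (hJ : 2 * ((T : ℝ) + 1) ^ 2 ≤ J) (ψ : Config (siteDim n T) → ℂ) :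
    ∑ x, ‖ψ x‖ ^ 2 ≤ J * ∑ s : Fin T, ∑ x, ‖(stepDiff s *ᵥ ψ) x‖ ^ 2 +
      ∑ x, J * penalty x * ‖ψ x‖ ^ 2 + ∑ d : TreeData n with IsGoodInput d,
        ‖∑ t ∈ Finset.range (T + 1), ψ (history T d t)‖ ^ 2 / (T + 1) := by
  have hT0 : (0 : ℝ) ≤ T := by positivity
  have hJ1 : 2 * ((T : ℝ) + 1) ≤ J := by nlinarith
  have hJ2 : 1 ≤ J := by linarith
  refine sum_paths_le T (history T) history_inj (fun x => J * penalty x)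
    (fun x => mul_nonneg (by linarith) (penalty_nonneg x)) (fun x hx => ?_) IsGoodInput
    (fun d hd => ?_) hJ _ ψ fun s => ?_
  · have : 1 ≤ penalty x := by
      by_contra hcon
      obtain ⟨d, t, ht, h⟩ := exists_history_eq x fun t h1 h2 h3 =>
        hcon (one_le_penalty_of_clock h1 h2 h3)
      exact hx d t ht h
    nlinarith
  · obtain ⟨t, ht, h⟩ := exists_penalty_of_not_good hd hn hT
    exact ⟨t, ht, by nlinarith⟩
  -- The energy of a step runs over all basis states, including illegal clocks. The histories at
  -- time `s` are distinct ones among these, so their differences are bounded by it.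
  · have hinj : Set.InjOn (fun d : TreeData n => history T d s.val) (Finset.univ : Finset (TreeData n)) :=
      fun d _ d' _ h => (history_inj d d' s s s.2.le s.2.le h).1
    have hval : ∀ d : TreeData n, ‖ψ (history T d (s.val + 1)) - ψ (history T d s.val)‖ ^ 2 =
        ‖(stepDiff s *ᵥ ψ) (history T d s.val)‖ ^ 2 := by
      intro d
      rw [stepDiff_mulVec, if_pos (beforeStep_history s d), stepConf_history]
    rw [Finset.sum_congr rfl fun d _ => hval d,
      ← Finset.sum_image (f := fun x => ‖(stepDiff s *ᵥ ψ) x‖ ^ 2) hinj]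
    exact Finset.sum_le_sum_of_subset_of_nonneg (Finset.subset_univ _) fun _ _ _ => by positivity

/-- The good inputs. -/
abbrev GoodInput (n : ℕ) : Type := {d : TreeData n // IsGoodInput d}

variable (n T) in
/-- Columns: sums of the basis states of the good histories over the times in `I`. -/
noncomputable def historySum (I : Finset ℕ) : Matrix (Config (siteDim n T)) (GoodInput n) ℂ :=
  Matrix.of fun x g => ∑ t ∈ I, if x = history T g.1 t then 1 else 0

/-- History states are distinct basis vectors, so only equal inputs at common times contribute. -/
theorem historySum_conjTranspose_mul {I I' : Finset ℕ} (hI : I ⊆ Finset.range (T + 1))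
    (hI' : I' ⊆ Finset.range (T + 1)) :
    (historySum n T I)ᴴ * historySum n T I' = ((I ∩ I').card : ℂ) • (1 : Matrix (GoodInput n) (GoodInput n) ℂ) := by
  ext g g'
  rw [Matrix.mul_apply]
  simp only [historySum, Matrix.conjTranspose_apply, Matrix.of_apply, star_sum, Finset.sum_mul_sum]
  rw [Finset.sum_comm]
  simp only [Finset.sum_comm (s := Finset.univ) (t := I')]
  have hterm : ∀ t ∈ I, ∀ t' ∈ I', (∑ x : Config (siteDim n T),
      star (if x = history T g.1 t then (1 : ℂ) else 0) *
        (if x = history T g'.1 t' then 1 else 0)) = if g = g' then if t = t' then 1 else 0 else 0 := by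
    intro t ht t' ht'
    have ht := Finset.mem_range.1 (hI ht)
    have ht' := Finset.mem_range.1 (hI' ht')
    rw [Finset.sum_eq_single (history T g.1 t)]
    · by_cases h : history T g.1 t = history T g'.1 t'
      · obtain ⟨h1, h2⟩ := history_inj _ _ _ _ (by omega) (by omega) h
        simp [Subtype.ext h1, h2]
      · have : ¬ (g = g' ∧ t = t') := by
          rintro ⟨rfl, rfl⟩
          exact h rfl
        rw [if_neg h, mul_zero]
        split_ifs <;> simp_all
    · intro x _ hx
      simp [hx]
    · simp
  rw [Finset.sum_congr rfl fun t ht => Finset.sum_congr rfl fun t' ht' => hterm t ht t' ht']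
  by_cases hg : g = g'
  · subst hg
    simp [Finset.sum_ite_eq]
  · simp [hg]

variable (n T) in
/-- Columns: uniform superpositions of the good histories over the times in `I`. -/
noncomputable def historyState (I : Finset ℕ) :
    Matrix (Config (siteDim n T)) (GoodInput n) ℂ :=
  (((√(I.card : ℝ))⁻¹ : ℝ) : ℂ) • historySum n T I

theorem historyState_conjTranspose_mul {I I' : Finset ℕ} (hI : I ⊆ I')
    (hI' : I' ⊆ Finset.range (T + 1)) :
    (historyState n T I')ᴴ * historyState n T I =
      ((√(I.card : ℝ) / √(I'.card : ℝ) : ℝ) : ℂ) • (1 : Matrix (GoodInput n) (GoodInput n) ℂ) := by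
  rw [historyState, historyState, Matrix.conjTranspose_smul, Matrix.smul_mul, Matrix.mul_smul,
    historySum_conjTranspose_mul hI' (hI.trans hI'), Finset.inter_eq_right.2 hI, smul_smul,
    smul_smul, Complex.star_def, Complex.conj_ofReal]
  congr 1
  rw [← Complex.ofReal_natCast, ← Complex.ofReal_mul, ← Complex.ofReal_mul]
  congr 1
  have h := Real.mul_self_sqrt (Nat.cast_nonneg (α := ℝ) I.card)
  rcases eq_or_ne (√(I.card : ℝ)) 0 with h0 | h0
  · simp [h0]
  · rw [div_eq_mul_inv, mul_comm (√(I.card : ℝ))]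
    rw [show (I.card : ℝ) = √(I.card : ℝ) * √(I.card : ℝ) from h.symm]
    rw [Real.sqrt_mul_self (Real.sqrt_nonneg _)]
    field_simp

theorem historyState_isometry {I : Finset ℕ} (hI : I ⊆ Finset.range (T + 1)) (h0 : I.Nonempty) :
    (historyState n T I)ᴴ * historyState n T I = (1 : Matrix (GoodInput n) (GoodInput n) ℂ) := by
  rw [historyState_conjTranspose_mul subset_rfl hI, div_self, Complex.ofReal_one, one_smul]
  exact (Real.sqrt_pos.2 (by exact_mod_cast h0.card_pos)).ne'

/-- Each summand annihilates the columns: penalties vanish along good histories, and amplitudes are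
constant along them. -/
theorem treeCircuitHamiltonian_mul_historyState (hn : 2 ≤ n) (J : ℝ) :
    treeCircuitHamiltonian n T J J J J * historyState n T (Finset.range (T + 1)) =
      (0 : Matrix (Config (siteDim n T)) (GoodInput n) ℂ) := by
  rw [historyState, Matrix.mul_smul]
  have : treeCircuitHamiltonian n T J J J J * historySum n T (Finset.range (T + 1)) =
      (0 : Matrix (Config (siteDim n T)) (GoodInput n) ℂ) := by
    rw [treeCircuitHamiltonian_eq, Matrix.add_mul, Matrix.smul_mul, Matrix.sum_mul,
      Finset.sum_eq_zero, smul_zero, zero_add]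
    · ext x g
      rw [Matrix.diagonal_mul, Matrix.zero_apply, historySum, Matrix.of_apply, Finset.mul_sum]
      refine Finset.sum_eq_zero fun t ht => ?_
      split_ifs with h
      · rw [h, g.2.penalty_history hn (by have := Finset.mem_range.1 ht; omega)]
        simp
      · simp
    · intro s _
      rw [Matrix.mul_assoc]
      have hs : stepDiff (n := n) s * historySum n T (Finset.range (T + 1)) =
          (0 : Matrix (Config (siteDim n T)) (GoodInput n) ℂ) := by
        ext x g
        have h1 : (stepDiff (n := n) s * historySum n T (Finset.range (T + 1)) :
            Matrix (Config (siteDim n T)) (GoodInput n) ℂ) x g =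
            (stepDiff s *ᵥ fun z => historySum n T (Finset.range (T + 1)) z g) x := rfl
        rw [h1, stepDiff_mulVec]
        split_ifs with hx
        · simp only [historySum, Matrix.of_apply, sum_history_stepConf s hx, sub_self,
            Matrix.zero_apply]
        · rfl
      rw [hs, Matrix.mul_zero]
  rw [this, smul_zero]

variable (n T) in
/-- The projector onto the uniform superpositions of the good histories over the times in `I`. -/
noncomputable def historyProjector (I : Finset ℕ) : Op (siteDim n T) :=
  historyState n T I * (historyState n T I)ᴴ

theorem form_historyProjector (ψ : Config (siteDim n T) → ℂ) :
    star ψ ⬝ᵥ (historyProjector n T (Finset.range (T + 1)) *ᵥ ψ) =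
      ((∑ d : TreeData n with IsGoodInput d,
        ‖∑ t ∈ Finset.range (T + 1), ψ (history T d t)‖ ^ 2 / (T + 1) : ℝ) : ℂ) := by
  have h := form_conjTranspose_mul_self (historyState n T (Finset.range (T + 1)))ᴴ ψ
  rw [Matrix.conjTranspose_conjTranspose] at h
  rw [historyProjector, h]
  congr 1
  rw [Finset.sum_subtype (p := IsGoodInput) _ (by simp)]
  refine Finset.sum_congr rfl fun g _ => ?_
  rw [historyState, Matrix.conjTranspose_smul, Matrix.smul_mulVec, Pi.smul_apply, smul_eq_mul,
    norm_mul, mul_pow, Complex.star_def, Complex.conj_ofReal, Complex.norm_real, Real.norm_eq_abs,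
    sq_abs, inv_pow, Real.sq_sqrt (Nat.cast_nonneg _), Finset.card_range, inv_mul_eq_div]
  push_cast
  congr 3
  simp only [Matrix.mulVec, dotProduct, historySum, Matrix.conjTranspose_apply, Matrix.of_apply,
    star_sum, Finset.sum_mul]
  rw [Finset.sum_comm]
  refine Finset.sum_congr rfl fun t _ => ?_
  rw [Finset.sum_eq_single (history T g.1 t)] <;> simp +contextual

instance : Nonempty (GoodInput n) := ⟨⟨0, rfl, by simp⟩⟩

theorem isQuasiGroundspace_treeCircuitHamiltonian (hn : 2 ≤ n) (hT : n - 1 ≤ T) {J : ℝ}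
    (hJ : 2 * ((T : ℝ) + 1) ^ 2 ≤ J) :
    IsQuasiGroundspace (treeCircuitHamiltonian n T J J J J)
      (historyProjector n T (Finset.range (T + 1))) 0 1 := by
  have hiso := historyState_isometry (n := n) (T := T) subset_rfl ⟨0, by simp⟩
  have hproj : IsProjector (historyProjector n T (Finset.range (T + 1))) :=
    isProjector_of_isometry hiso
  refine (isQuasiGroundspace_of_form (treeCircuitHamiltonian_isHermitian J) hproj ?_ ?_ (fun ψ => ?_) (fun ψ => ?_)).2
  · rw [historyProjector, ← Matrix.mul_assoc, treeCircuitHamiltonian_mul_historyState hn, Matrix.zero_mul]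
  · intro h
    have h1 := congrArg (fun X : Op (siteDim n T) =>
      ((historyState n T (Finset.range (T + 1)))ᴴ * X *
        historyState n T (Finset.range (T + 1)) : Matrix (GoodInput n) (GoodInput n) ℂ)) h
    simp only [historyProjector, ← Matrix.mul_assoc, hiso, Matrix.one_mul, Matrix.mul_zero, Matrix.zero_mul] at h1
    exact one_ne_zero h1
  · rw [form_treeCircuitHamiltonian, Complex.ofReal_re]
    have hJ0 : 0 ≤ J := le_trans (by positivity) hJ
    refine add_nonneg (mul_nonneg hJ0 (Finset.sum_nonneg fun _ _ => Finset.sum_nonneg fun _ _ =>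
      by positivity)) (Finset.sum_nonneg fun x _ => mul_nonneg (mul_nonneg hJ0 (penalty_nonneg x))
        (by positivity))
  · rw [Matrix.add_mulVec, dotProduct_add, Complex.add_re, form_treeCircuitHamiltonian,
      form_historyProjector, Complex.ofReal_re, Complex.ofReal_re]
    exact sum_norm_sq_le_energy hn hT hJ ψ

end CircuitGap

/-! ### The groundspace of `H_A` -/

section SourceHamiltonian

variable {n : ℕ}

/-- The number of pairs of excitations. -/
def excitedPairs (x : Config (qubitDim n)) : ℕ :=
  ((Finset.powersetCard 2 (Finset.univ : Finset (Fin n))).filter fun S => ∀ i ∈ S, x i = 1).card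

theorem HA_total : (HA n).total = Matrix.diagonal (fun x => ((excitedPairs x : ℝ) : ℂ)) := by
  unfold LocalHamiltonian.total HA
  dsimp only
  rw [sum_diagonal]
  congr 1
  funext x
  rw [Finset.sum_boole, excitedPairs]
  simp

theorem excitedPairs_eq_zero_iff (x : Config (qubitDim n)) :
    excitedPairs x = 0 ↔ ∑ i, (x i).val ≤ 1 := by
  have hsum : ∑ i, (x i).val = (Finset.univ.filter fun i => x i = 1).card := by
    rw [Finset.card_filter]
    refine Finset.sum_congr rfl fun i _ => ?_
    have key : ∀ a : Fin 2, a.val = if a = 1 then 1 else 0 := by decide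
    exact key (x i)
  rw [hsum, excitedPairs, Finset.card_eq_zero, Finset.filter_eq_empty_iff]
  constructor
  · intro h
    by_contra hcon
    obtain ⟨S, hS, hc⟩ := Finset.exists_subset_card_eq (n := 2)
      (s := Finset.univ.filter fun i => x i = 1) (by omega)
    exact h (Finset.mem_powersetCard.2 ⟨Finset.subset_univ S, hc⟩) fun i hi =>
      (Finset.mem_filter.1 (hS hi)).2
  · intro h S hS hall
    have := Finset.card_le_card (s := S) (t := Finset.univ.filter fun i => x i = 1)
      fun i hi => Finset.mem_filter.2 ⟨Finset.mem_univ i, hall i hi⟩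
    rw [(Finset.mem_powersetCard.1 hS).2] at this
    omega

/-- Exhibits the eigenvalue `1`, so that the gap of `H_A` is exactly `1` and not only bounded below
by it. -/
theorem exists_excitedPairs_eq_one (hn : 2 ≤ n) :
    ∃ x : Config (qubitDim n), excitedPairs x = 1 := by
  let U : Finset (Fin n) := {⟨0, by omega⟩, ⟨1, by omega⟩}
  have hU : U.card = 2 := Finset.card_pair (by simp)
  let x : Config (qubitDim n) := fun i => if i ∈ U then (1 : Fin 2) else (0 : Fin 2)
  have hx : ∀ i, x i = 1 ↔ i ∈ U := by
    intro i
    change (if i ∈ U then (1 : Fin 2) else (0 : Fin 2)) = 1 ↔ _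
    split_ifs with h <;> simp [h]
  refine ⟨x, ?_⟩
  rw [excitedPairs, Finset.card_eq_one]
  refine ⟨U, ?_⟩
  ext S
  simp only [Finset.mem_filter, Finset.mem_powersetCard, Finset.subset_univ, true_and, hx,
    Finset.mem_singleton]
  constructor
  · rintro ⟨hc, hS⟩
    exact Finset.eq_of_subset_of_card_le hS (by omega)
  · rintro rfl
    exact ⟨hU, fun i hi => hi⟩

variable (n) in
/-- The projector onto the states with at most one excitation. -/
def sourceProjector : Matrix (Config (qubitDim n)) (Config (qubitDim n)) ℂ :=
  Matrix.diagonal (fun x => ((if ∑ i, (x i).val ≤ 1 then 1 else 0 : ℝ) : ℂ))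

theorem isGroundspace_HA (hn : 2 ≤ n) : IsGroundspace (HA n).total (sourceProjector n) 1 := by
  have hmain : IsLeast (spectrum ℝ (HA n).total) 0 ∧
      IsQuasiGroundspace (HA n).total (sourceProjector n) 0 1 := by
    rw [HA_total]
    refine isQuasiGroundspace_of_form ?_ ⟨?_, ?_⟩ ?_ ?_ (fun v => ?_) (fun v => ?_)
    · rw [Matrix.IsHermitian, Matrix.diagonal_conjTranspose]
      congr 1
      funext x
      simp
    · rw [sourceProjector, Matrix.IsHermitian, Matrix.diagonal_conjTranspose]
      congr 1
      funext x
      simp only [Pi.star_apply]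
      split_ifs <;> simp
    · rw [sourceProjector, Matrix.diagonal_mul_diagonal]
      congr 1
      funext x
      split_ifs <;> simp
    · rw [sourceProjector, Matrix.diagonal_mul_diagonal, ← Matrix.diagonal_zero]
      congr 1
      funext x
      split_ifs with h
      · simp [(excitedPairs_eq_zero_iff x).2 h]
      · simp
    · intro h
      have h1 := congrFun (congrFun h fun _ => (0 : Fin 2)) fun _ => (0 : Fin 2)
      rw [sourceProjector, Matrix.diagonal_apply_eq] at h1
      simp at h1
    · rw [form_diagonal, Complex.ofReal_re]
      exact Finset.sum_nonneg fun _ _ => by positivity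
    · rw [Matrix.add_mulVec, dotProduct_add, sourceProjector, form_diagonal, form_diagonal,
        Complex.add_re, Complex.ofReal_re, Complex.ofReal_re, ← Finset.sum_add_distrib]
      refine Finset.sum_le_sum fun x _ => ?_
      rw [← add_mul]
      refine le_mul_of_one_le_left (by positivity) ?_
      split_ifs with h
      · simp
      · have h1 : excitedPairs x ≠ 0 := fun h0 => h ((excitedPairs_eq_zero_iff x).1 h0)
        have h2 : 1 ≤ excitedPairs x := by omega
        have h3 : (1 : ℝ) ≤ excitedPairs x := by exact_mod_cast h2
        linarith
  refine ⟨hmain.2, 0, hmain.1, ⟨1, ?_, one_ne_zero, by simp⟩, ?_⟩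
  · obtain ⟨x, hx⟩ := exists_excitedPairs_eq_one hn
    rw [mem_spectrum_real_iff]
    refine ⟨Pi.single x 1, by simp, ?_⟩
    rw [HA_total, Matrix.diagonal_mulVec_single, hx]
    simp
  · rintro δ ⟨μ, hμ, hμ0, rfl⟩
    obtain ⟨v, hv, hvμ⟩ := (mem_spectrum_real_iff _ _).1 hμ
    obtain ⟨x, hx⟩ := Function.ne_iff.1 hv
    have h1 := congrFun hvμ x
    rw [HA_total, Matrix.mulVec_diagonal, Pi.smul_apply, smul_eq_mul] at h1
    have h2 : (excitedPairs x : ℝ) = μ := Complex.ofReal_injective (mul_right_cancel₀ hx h1)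
    rw [← h2] at hμ0 ⊢
    have h3 : 1 ≤ excitedPairs x := by
      rw [Nat.one_le_iff_ne_zero]
      exact_mod_cast hμ0
    rw [sub_zero]
    exact_mod_cast h3

end SourceHamiltonian

/-! ### The trivial encoding and the incoherence -/

section Encoding

/-- The parts of a basis state on the original and on the additional qudits. -/
def splitConf {ι κ : Type} (d : ι → ℕ) (e : κ → ℕ) :
    Config (Sum.elim d e) ≃ Config d × Config e :=
  Equiv.sumPiEquivProdPi (fun i => Fin (Sum.elim d e i))

variable {ι κ : Type} [Fintype ι] [Fintype κ] {d : ι → ℕ} {e : κ → ℕ}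

theorem trivialEncoding_apply (z : Config (Sum.elim d e)) (p : Config d × Config e) :
    trivialEncoding d e z p = if splitConf d e z = p then 1 else 0 := by
  unfold trivialEncoding
  congr 1
  rw [Prod.ext_iff, funext_iff, funext_iff, eq_iff_iff]
  refine and_congr (forall_congr' fun i => ?_) (forall_congr' fun j => ?_)
  · exact (Fin.ext_iff (a := splitConf d e z |>.1 i) (b := p.1 i)).symm
  · exact (Fin.ext_iff (a := splitConf d e z |>.2 j) (b := p.2 j)).symm

theorem trivialEncoding_isometry [DecidableEq ι] [DecidableEq κ] : (trivialEncoding d e)ᴴ * trivialEncoding d e = 1 := by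
  ext p p'
  rw [Matrix.mul_apply, ← (splitConf d e).symm.sum_comp]
  simp only [Matrix.conjTranspose_apply, trivialEncoding_apply, Equiv.apply_symm_apply]
  rw [Finset.sum_eq_single p]
  · simp [Matrix.one_apply]
  · intro r _ hr
    simp [hr]
  · simp

theorem trivialEncoding_conj [DecidableEq ι] [DecidableEq κ]
    (M : Matrix (Config d × Config e) (Config d × Config e) ℂ)
    (z z' : Config (Sum.elim d e)) :
    (trivialEncoding d e * M * (trivialEncoding d e)ᴴ) z z' =
      M (splitConf d e z) (splitConf d e z') := by
  rw [Matrix.mul_apply, Finset.sum_eq_single (splitConf d e z')]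
  · rw [Matrix.mul_apply, Finset.sum_eq_single (splitConf d e z)]
    · simp [trivialEncoding_apply]
    · intro r _ hr
      rw [trivialEncoding_apply, if_neg hr.symm, zero_mul]
    · simp
  · intro r _ hr
    rw [Matrix.conjTranspose_apply, trivialEncoding_apply, if_neg hr.symm, star_zero, mul_zero]
  · simp

variable {n T : ℕ}

variable (n T) in
/-- The state of the additional qudits at time `t`, with all ancillas in the state `0`. -/
def idleConf (t : ℕ) : Config (workDim n T)
  | Sum.inl _ => (0 : Fin 3)
  | Sum.inr s => clockState T t s

variable (n T) in
/-- The uniform superposition of the additional qudits over the times in `I`. -/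
noncomputable def idleState (I : Finset ℕ) : Matrix (Config (workDim n T)) Unit ℂ :=
  Matrix.of fun w _ => (((√(I.card : ℝ))⁻¹ : ℝ) : ℂ) * ∑ t ∈ I, if w = idleConf n T t then 1 else 0

theorem idleState_isometry {I : Finset ℕ} (hI : I ⊆ Finset.range (T + 1)) (h0 : I.Nonempty) :
    (idleState n T I)ᴴ * idleState n T I = 1 := by
  ext u u'
  have hcard : (0 : ℝ) < I.card := by exact_mod_cast h0.card_pos
  have hinner : ∑ w : Config (workDim n T), star (∑ t ∈ I, if w = idleConf n T t then (1 : ℂ) else 0)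
      * (∑ t ∈ I, if w = idleConf n T t then 1 else 0) = I.card := by
    simp only [star_sum, Finset.sum_mul_sum]
    rw [Finset.sum_comm]
    simp only [Finset.sum_comm (s := Finset.univ) (t := I)]
    rw [Finset.sum_congr rfl (g := fun _ => (1 : ℂ))]
    · simp
    · intro t ht
      rw [Finset.sum_eq_single t]
      · rw [Finset.sum_eq_single (idleConf n T t)] <;> simp +contextual
      · intro t' ht' hne
        refine Finset.sum_eq_zero fun w _ => ?_
        by_cases h1 : w = idleConf n T t
        · rw [if_neg (c := w = idleConf n T t'), mul_zero]
          intro h2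
          have ht := Finset.mem_range.1 (hI ht)
          have ht' := Finset.mem_range.1 (hI ht')
          refine hne (clockState_inj (T := T) (by omega) (by omega) (funext fun s => ?_))
          exact congrFun (h2.symm.trans h1) (Sum.inr s)
        · simp [h1]
      · exact fun h => (h ht).elim
  rw [Matrix.mul_apply, Matrix.one_apply_eq]
  simp only [idleState, Matrix.conjTranspose_apply, Matrix.of_apply, star_mul']
  have : ∀ (c : ℂ) (f : Config (workDim n T) → ℂ),
      ∑ w, star c * star (f w) * (c * f w) = star c * c * ∑ w, star (f w) * f w := by
    intro c f
    rw [Finset.mul_sum]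
    exact Finset.sum_congr rfl fun _ _ => by ring
  rw [this, hinner, Complex.star_def, Complex.conj_ofReal, ← Complex.ofReal_mul,
    ← Complex.ofReal_natCast, ← Complex.ofReal_mul, ← mul_inv, Real.mul_self_sqrt hcard.le,
    inv_mul_cancel₀ hcard.ne', Complex.ofReal_one]

/-- At idle times a good computation has returned to its input with zero ancillas, so qubits and
additional qudits are in a product state, whose second factor does not depend on the input. -/
theorem historyState_apply (hn : 2 ≤ n) {I : Finset ℕ} (hI : ∀ t ∈ I, 2 * n - 3 ≤ t)
    (z : Config (siteDim n T)) (g : GoodInput n) :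
    historyState n T I z g = if (splitConf (qubitDim n) (workDim n T) z).1 = g.1.1 then
      idleState n T I (splitConf (qubitDim n) (workDim n T) z).2 () else 0 := by
  have hiff : ∀ t ∈ I, (z = history T g.1 t ↔
      (splitConf (qubitDim n) (workDim n T) z).1 = g.1.1 ∧
        (splitConf (qubitDim n) (workDim n T) z).2 = idleConf n T t) := by
    intro t ht
    rw [history, g.2.circuit_of_le hn (hI t ht), eq_joinConf_iff, Prod.ext_iff, g.2.1, and_assoc]
    refine and_congr Iff.rfl ⟨fun h => ?_, fun h => ⟨?_, ?_⟩⟩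
    · funext i
      rcases i with v | s
      · exact congrFun h.1 v
      · exact congrFun h.2 s
    · exact funext fun v => congrFun h (Sum.inl v)
    · exact funext fun s => congrFun h (Sum.inr s)
  simp only [historyState, historySum, idleState, Matrix.smul_apply, Matrix.of_apply, smul_eq_mul]
  have hterm : ∀ t ∈ I, (if z = history T g.1 t then (1 : ℂ) else 0) =
      if (splitConf (qubitDim n) (workDim n T) z).1 = g.1.1 ∧
        (splitConf (qubitDim n) (workDim n T) z).2 = idleConf n T t then 1 else 0 := fun t ht => by
    simp only [hiff t ht]
  rw [Finset.sum_congr rfl hterm]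
  split_ifs with h
  · simp [h]
  · simp [h]

/-- The qubit parts of good inputs are the basis states in the range of `sourceProjector`; summing
the product states over them gives the Kronecker product. -/
theorem encoded_projector_eq (hn : 2 ≤ n) {I : Finset ℕ} (hI : ∀ t ∈ I, 2 * n - 3 ≤ t) :
    trivialEncoding (qubitDim n) (workDim n T) *
      (sourceProjector n ⊗ₖ (idleState n T I * (idleState n T I)ᴴ)) *
      (trivialEncoding (qubitDim n) (workDim n T))ᴴ =
    historyProjector n T I := by
  ext z z'
  rw [historyProjector, trivialEncoding_conj, Matrix.kronecker_apply, Matrix.mul_apply, Matrix.mul_apply]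
  simp only [Matrix.conjTranspose_apply, historyState_apply hn hI, Finset.univ_unique,
    Finset.sum_singleton, sourceProjector, Matrix.diagonal_apply]
  generalize splitConf (qubitDim n) (workDim n T) z = p
  generalize splitConf (qubitDim n) (workDim n T) z' = p'
  by_cases hp : p.1 = p'.1
  · rw [if_pos hp]
    by_cases hg : ∑ i, (p.1 i).val ≤ 1
    · rw [Finset.sum_eq_single (⟨(p.1, 0), rfl, hg⟩ : GoodInput n)]
      · rw [if_pos hg, if_pos rfl, if_pos hp.symm, Complex.ofReal_one, one_mul]
      · intro g _ hne
        rw [if_neg, zero_mul]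
        intro h
        exact hne (Subtype.ext (Prod.ext h.symm g.2.1))
      · simp
    · rw [if_neg hg, Finset.sum_eq_zero]
      · simp
      · intro g _
        rw [if_neg, zero_mul]
        intro h
        exact hg (h ▸ g.2.2)
  · rw [if_neg hp, zero_mul, Finset.sum_eq_zero]
    intro g _
    by_cases h : p.1 = g.1.1
    · rw [if_neg (c := p'.1 = g.1.1) (fun h' => hp (h.trans h'.symm)), star_zero, mul_zero]
    · rw [if_neg h, zero_mul]

theorem treeCircuitHamiltonian_gapSimulates (hn : 2 ≤ n) (hT : 2 * n - 3 ≤ T) {J ε : ℝ}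
    (hJ : 2 * ((T : ℝ) + 1) ^ 2 ≤ J) (hε : 0 ≤ ε)
    (hTε : 8 * ((2 * n - 3 : ℕ) : ℝ) ≤ ε ^ 2 * (T + 1)) :
    GapSimulates (HA n).total (treeCircuitHamiltonian n T J J J J)
      (trivialEncoding (qubitDim n) (workDim n T)) ε 0 := by
  have hI : Finset.Ico (2 * n - 3) (T + 1) ⊆ Finset.range (T + 1) := by
    intro t ht
    simp only [Finset.mem_Ico, Finset.mem_range] at *
    exact ht.2
  have hI0 : (Finset.Ico (2 * n - 3) (T + 1)).Nonempty := ⟨T, by simp; omega⟩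
  refine ⟨sourceProjector n, 1, isGroundspace_HA hn, trivialEncoding_isometry,
    ⟨0, (isGroundspace_HA hn).1⟩, _,
    isQuasiGroundspace_treeCircuitHamiltonian hn (by omega) hJ,
    idleState n T (Finset.Ico (2 * n - 3) (T + 1)) *
      (idleState n T (Finset.Ico (2 * n - 3) (T + 1)))ᴴ,
    isProjector_of_isometry (idleState_isometry hI hI0), ?_⟩
  rw [encoded_projector_eq hn fun t ht => (Finset.mem_Ico.1 ht).1]
  refine norm_projector_sub_le (historyState_isometry subset_rfl ⟨0, by simp⟩)
    (historyState_isometry hI hI0) (historyState_conjTranspose_mul hI subset_rfl) hε ?_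
  simp only [Nat.card_Ico, Finset.card_range]
  have hN : (0 : ℝ) < (T : ℝ) + 1 := by positivity
  have hcast : ((T + 1 - (2 * n - 3) : ℕ) : ℝ) = (T : ℝ) + 1 - ((2 * n - 3 : ℕ) : ℝ) := by
    rw [Nat.cast_sub (by omega)]
    push_cast
    ring
  set ρ : ℝ := √((T + 1 - (2 * n - 3) : ℕ) : ℝ) / √((T + 1 : ℕ) : ℝ) with hρ
  have hρ0 : 0 ≤ ρ := by positivity
  have hρ2 : ρ ^ 2 = ((T : ℝ) + 1 - ((2 * n - 3 : ℕ) : ℝ)) / (T + 1) := by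
    rw [hρ, div_pow, Real.sq_sqrt (Nat.cast_nonneg _), Real.sq_sqrt (Nat.cast_nonneg _), hcast]
    push_cast
    rfl
  have hm : (0 : ℝ) ≤ ((2 * n - 3 : ℕ) : ℝ) := Nat.cast_nonneg _
  have hsq : 1 - ρ ^ 2 = ((2 * n - 3 : ℕ) : ℝ) / (T + 1) := by
    rw [hρ2]
    field_simp
    ring
  have hle : 8 * (1 - ρ ^ 2) ≤ ε ^ 2 := by
    rw [hsq, mul_div_assoc', div_le_iff₀ hN]
    exact hTε
  -- For `0 ≤ ρ ≤ 1` one has `1 - ρ ≤ 1 - ρ ^ 2`, so the bound on `ρ ^ 2` suffices.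
  have hρ1 : ρ ≤ 1 := by
    have : 0 ≤ 1 - ρ ^ 2 := by rw [hsq]; positivity
    nlinarith
  nlinarith

end Encoding

/-! ### The circuit Hamiltonian as a local Hamiltonian -/

section Locality

variable {n T : ℕ}

/-- Labels of the qudits: nodes of the tree and positions in the clock. -/
def siteLabel : Fin n ⊕ (Fin (n - 1) ⊕ Fin T) → ℕ ⊕ ℕ
  | Sum.inl i => Sum.inl (n + i.val)
  | Sum.inr (Sum.inl v) => Sum.inl (v.val + 1)
  | Sum.inr (Sum.inr s) => Sum.inr s.val

theorem siteLabel_injective : Function.Injective (siteLabel (n := n) (T := T)) := by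
  rintro (i | v | s) (i' | v' | s') h <;> simp [siteLabel] at h <;> first
    | (have := v.2; omega)
    | (have := v'.2; omega)
    | (congr; exact Fin.ext (by omega))

variable (n) in
/-- The node of the gate at time `s + 1`; for identity gates, a node outside of the tree. -/
def gateNode (s : ℕ) : ℕ :=
  if s + 1 < n then n - (s + 1) else if n ≤ s + 1 ∧ s + 4 ≤ 2 * n then s + 3 - n else 2 * n

variable (n) in
/-- The labels of the qudits in the propagation term at time `s + 1`. -/
def supportLabels (s : ℕ) : Finset (ℕ ⊕ ℕ) :=
  -- At `s = 0` truncated subtraction repeats clock label `0`, and at `s = T - 1` the label `s + 1`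
  -- belongs to no qudit; this matches the formal clock bits at both ends.
  {Sum.inl (gateNode n s), Sum.inl (2 * gateNode n s), Sum.inl (2 * gateNode n s + 1),
    Sum.inr (s - 1), Sum.inr s, Sum.inr (s + 1)}

variable (n) in
/-- The qudits in the propagation term at time `s + 1`. -/
def stepSupport (s : Fin T) : Finset (Fin n ⊕ (Fin (n - 1) ⊕ Fin T)) :=
  Finset.univ.filter fun i => siteLabel i ∈ supportLabels n s.val

theorem mem_stepSupport {s : Fin T} {i : Fin n ⊕ (Fin (n - 1) ⊕ Fin T)} :
    i ∈ stepSupport n s ↔ siteLabel i ∈ supportLabels n s.val := by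
  simp [stepSupport]

theorem card_stepSupport_le (s : Fin T) : (stepSupport n s).card ≤ 6 :=
  (Finset.card_le_card_of_injOn siteLabel (fun _ hi => mem_stepSupport.1 hi)
    siteLabel_injective.injOn).trans Finset.card_le_six

theorem card_steps_le (i : Fin n ⊕ (Fin (n - 1) ⊕ Fin T)) :
    (Finset.univ.filter fun s : Fin T => i ∈ stepSupport n s).card ≤ 6 := by
  obtain ⟨N, hN, hsub⟩ : ∃ N : Finset ℕ, N.card ≤ 6 ∧
      ∀ s : Fin T, i ∈ stepSupport n s → s.val ∈ N := by
    have hnode : ∀ m, 1 ≤ m → m < 2 * n → siteLabel i = Sum.inl m →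
        ∃ N : Finset ℕ, N.card ≤ 6 ∧ ∀ s : Fin T, i ∈ stepSupport n s → s.val ∈ N := by
      intro m hm1 hm2 him
      -- The times when node `m` is counted and uncounted, followed by those of its parent `m / 2`.
      refine ⟨{n - 1 - m, m + n - 3, n - 1 - m / 2, m / 2 + n - 3},
        Finset.card_le_four.trans (by norm_num), fun s hs => ?_⟩
      rw [mem_stepSupport, him] at hs
      simp only [supportLabels, Finset.mem_insert, Finset.mem_singleton, Sum.inl.injEq,
        reduceCtorEq, or_false, gateNode] at hs ⊢
      split_ifs at hs <;> omega
    rcases i with i | v | j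
    · exact hnode (n + i.val) (by have := i.2; omega) (by have := i.2; omega) rfl
    · exact hnode (v.val + 1) (by omega) (by have := v.2; omega) rfl
    · refine ⟨{j.val - 1, j.val, j.val + 1}, Finset.card_le_three.trans (by norm_num),
        fun s hs => ?_⟩
      rw [mem_stepSupport] at hs
      simp only [siteLabel, supportLabels, Finset.mem_insert, Finset.mem_singleton, Sum.inr.injEq,
        reduceCtorEq, false_or] at hs ⊢
      omega
  exact (Finset.card_le_card_of_injOn Fin.val
    (fun s hs => hsub s (Finset.mem_filter.1 hs).2) (Fin.val_injective.injOn)).trans hN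

theorem nodeState_congr {x x' : Config (siteDim n T)} {v : ℕ}
    (h : ∀ i, siteLabel i = Sum.inl v → x i = x' i) : nodeState x v = nodeState x' v := by
  unfold nodeState
  split_ifs with h1 h2
  · rw [h]
    simp only [siteLabel, Sum.inl.injEq]
    omega
  · rw [h]
    simp only [siteLabel, Sum.inl.injEq]
    omega
  · rfl

theorem clockBit_congr {x x' : Config (siteDim n T)} {t : ℕ}
    (h : ∀ i, siteLabel i = Sum.inr (t - 1) → x i = x' i) : clockBit x t = clockBit x' t := by
  unfold clockBit
  split_ifs with h1 h2
  · rfl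
  · rw [h]
    rfl
  · rfl

/-- Basis states with equal states on the support of a propagation term. -/
def AgreeOn (s : Fin T) (x x' : Config (siteDim n T)) : Prop :=
  ∀ i ∈ stepSupport n s, x i = x' i

theorem AgreeOn.node {s : Fin T} {x x' : Config (siteDim n T)} (h : AgreeOn s x x') {v : ℕ}
    (hv : Sum.inl v ∈ supportLabels n s.val) : nodeState x v = nodeState x' v :=
  nodeState_congr fun i hi => h i (mem_stepSupport.2 (hi ▸ hv))

theorem AgreeOn.clock {s : Fin T} {x x' : Config (siteDim n T)} (h : AgreeOn s x x') {t : ℕ}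
    (ht : Sum.inr (t - 1) ∈ supportLabels n s.val) : clockBit x t = clockBit x' t :=
  clockBit_congr fun i hi => h i (mem_stepSupport.2 (hi ▸ ht))

theorem AgreeOn.clock_zero {s : Fin T} {x x' : Config (siteDim n T)} (h : AgreeOn s x x') :
    clockBit x s.val = clockBit x' s.val := h.clock (by simp [supportLabels])

theorem AgreeOn.clock_one {s : Fin T} {x x' : Config (siteDim n T)} (h : AgreeOn s x x') :
    clockBit x (s.val + 1) = clockBit x' (s.val + 1) := h.clock (by simp [supportLabels])

theorem AgreeOn.clock_two {s : Fin T} {x x' : Config (siteDim n T)} (h : AgreeOn s x x') :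
    clockBit x (s.val + 2) = clockBit x' (s.val + 2) := h.clock (by simp [supportLabels])

/-- Maps of the data which change the qutrit at the node `v + 1` only, in a way that depends on
this qutrit and the children only. -/
structure IsLocalMap (v : Fin (n - 1)) (f : TreeData n → TreeData n) : Prop where
  fst : ∀ d, (f d).1 = d.1
  of_ne : ∀ d w, w ≠ v → (f d).2 w = d.2 w
  congr : ∀ d d', d.2 v = d'.2 v →
    dataNode d (2 * (v.val + 1)) = dataNode d' (2 * (v.val + 1)) →
    dataNode d (2 * (v.val + 1) + 1) = dataNode d' (2 * (v.val + 1) + 1) → (f d).2 v = (f d').2 v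

theorem isLocalMap_countPerm (v : Fin (n - 1)) : IsLocalMap v (countPerm v) := by
  refine ⟨fun d => rfl, fun d w hw => ?_, fun d d' h1 h2 h3 => ?_⟩
  · simp [countData, hw]
  · simp [countData, h1, h2, h3]

theorem isLocalMap_countPerm_symm (v : Fin (n - 1)) : IsLocalMap v (countPerm v).symm := by
  have hfst : ∀ d, ((countPerm v).symm d).1 = d.1 := fun d => by
    have := (isLocalMap_countPerm v).fst ((countPerm v).symm d)
    rw [Equiv.apply_symm_apply] at this
    exact this.symm
  have hne : ∀ d w, w ≠ v → ((countPerm v).symm d).2 w = d.2 w := fun d w hw => by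
    have := (isLocalMap_countPerm v).of_ne ((countPerm v).symm d) w hw
    rw [Equiv.apply_symm_apply] at this
    exact this.symm
  refine ⟨hfst, hne, fun d d' h1 h2 h3 => ?_⟩
  -- Inverting the gate leaves the children unchanged, so the old qutrit solves an equation in which
  -- only the children and the new qutrit enter; injectivity of `countStep` makes the solution
  -- unique.
  have key : ∀ d, countStep (v.val = 0) (dataNode d (2 * (v.val + 1)))
      (dataNode d (2 * (v.val + 1) + 1)) (((countPerm v).symm d).2 v) = d.2 v := fun d => by
    have h := congrArg (fun e : TreeData n => e.2 v) ((countPerm v).apply_symm_apply d)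
    simp only [countPerm_apply, countData, Function.update_self] at h
    rwa [dataNode_congr v (hfst d) (hne d) (by omega),
      dataNode_congr v (hfst d) (hne d) (by omega)] at h
  have hd := key d
  rw [h1, h2, h3, ← key d'] at hd
  exact countStep_injective _ _ _ hd

theorem gatePerm_cases (s : ℕ) : gatePerm n (s + 1) = 1 ∨
    ∃ v : Fin (n - 1), gateNode n s = v.val + 1 ∧ IsLocalMap v (gatePerm n (s + 1)) := by
  unfold gatePerm gateNode
  by_cases h1 : s + 1 < n
  · right
    rw [dif_pos ⟨by omega, h1⟩, if_pos h1]
    exact ⟨_, by simp only; omega, isLocalMap_countPerm _⟩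
  · by_cases h2 : n ≤ s + 1 ∧ s + 1 + 3 ≤ 2 * n
    · right
      rw [dif_neg (by omega), dif_pos h2, if_neg h1, if_pos (by omega)]
      exact ⟨_, by simp only; omega, isLocalMap_countPerm_symm _⟩
    · left
      rw [dif_neg (by omega), dif_neg h2]

theorem stepConf_apply_ancilla (s : Fin T) (x : Config (siteDim n T)) (w : Fin (n - 1)) :
    stepConf s x (Sum.inr (Sum.inl w)) = (gatePerm n (s.val + 1) (dataOf x)).2 w := rfl

theorem stepConf_apply_qubit (s : Fin T) (x : Config (siteDim n T)) (i : Fin n) :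
    stepConf s x (Sum.inl i) = x (Sum.inl i) := by
  change (gatePerm n (s.val + 1) (dataOf x)).1 i = (dataOf x).1 i
  rcases gatePerm_cases (n := n) s.val with h | ⟨v, -, hv⟩
  · rw [h]
    rfl
  · rw [hv.fst]

theorem stepConf_apply_clock {s r : Fin T} (hr : r ≠ s) (x : Config (siteDim n T)) :
    stepConf s x (Sum.inr (Sum.inr r)) = x (Sum.inr (Sum.inr r)) :=
  Function.update_of_ne (β := fun _ => Fin 2) hr _ (clockOf x)

theorem actsOn_stepOp (s : Fin T) : ActsOn (stepOp s : Op (siteDim n T)) (stepSupport n s) := by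
  refine actsOn_partialMap (stepOp_apply s) (fun x x' h => ?_) (fun x i hi => ?_)
    (fun x x' h i hi => ?_)
  · have h : AgreeOn s x x' := h
    unfold BeforeStep
    rw [h.clock_zero, h.clock_one, h.clock_two]
  · rcases i with i | w | r
    · exact stepConf_apply_qubit s x i
    · rw [stepConf_apply_ancilla]
      change _ = (dataOf x).2 w
      rcases gatePerm_cases (n := n) s.val with h | ⟨v, hg, hv⟩
      · rw [h]
        rfl
      · refine hv.of_ne _ w ?_
        rintro rfl
        apply hi
        rw [mem_stepSupport]
        simp [siteLabel, supportLabels, hg]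
    · refine stepConf_apply_clock ?_ x
      rintro rfl
      apply hi
      rw [mem_stepSupport]
      simp [siteLabel, supportLabels]
  · have hA : AgreeOn s x x' := h
    rcases i with i | w | r
    · rw [stepConf_apply_qubit, stepConf_apply_qubit]
      exact h _ hi
    · rw [stepConf_apply_ancilla, stepConf_apply_ancilla]
      have hw : (dataOf x).2 w = (dataOf x').2 w := h _ hi
      rcases gatePerm_cases (n := n) s.val with h' | ⟨v, hg, hv⟩
      · rw [h']
        exact hw
      · by_cases hwv : w = v
        · subst hwv
          refine hv.congr _ _ hw ?_ ?_
          · exact hA.node (by simp [supportLabels, hg])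
          · exact hA.node (by simp [supportLabels, hg])
        · rw [hv.of_ne _ w hwv, hv.of_ne _ w hwv]
          exact hw
    · by_cases hr : r = s
      · subst hr
        exact (Function.update_self (β := fun _ => Fin 2) r _ (clockOf x)).trans
          (Function.update_self (β := fun _ => Fin 2) r _ (clockOf x')).symm
      · rw [stepConf_apply_clock hr, stepConf_apply_clock hr]
        exact h _ hi

theorem actsOn_hPropTerm (s : Fin T) :
    ActsOn (hPropTerm s : Op (siteDim n T)) (stepSupport n s) := by
  refine ((ActsOn.add (actsOn_diagonal fun x x' h => ?_)
    (actsOn_diagonal fun x x' h => ?_)).sub (actsOn_stepOp s)).sub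
      (actsOn_stepOp s).conjTranspose
  all_goals
    have h : AgreeOn s x x' := h
    rw [h.clock_zero, h.clock_one, h.clock_two]

/-- The sum of the terms of the circuit Hamiltonian which are grouped with the propagation term
at time `s + 1`. -/
noncomputable def stepTerm (s : Fin T) : Op (siteDim n T) :=
  hPropTerm s + basisProj (fun x => clockBit x s.val = 0 ∧ clockBit x (s.val + 1) = 1)
    + (if s.val + 1 < n then
        basisProj (fun x => nodeState x (n - (s.val + 1)) ≠ 0 ∧ clockBit x (s.val + 1) = 0) else 0)
    + (if s.val + 2 = n then
        basisProj (fun x => nodeState x 1 ≠ 0 ∧ clockBit x (s.val + 1) = 1) else 0)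

/-- The input check of a node is attached to the step that counts this node, and the output check to
the step of the root gate, so no qudit is added to the support. -/
theorem actsOn_stepTerm (s : Fin T) :
    ActsOn (stepTerm s : Op (siteDim n T)) (stepSupport n s) := by
  refine (((actsOn_hPropTerm s).add (actsOn_diagonal fun x x' h => ?_)).add ?_).add ?_
  · have h : AgreeOn s x x' := h
    rw [h.clock_zero, h.clock_one]
  · split_ifs with hs
    · refine actsOn_diagonal fun x x' h => ?_
      have h : AgreeOn s x x' := h
      rw [h.clock_one, h.node (v := n - (s.val + 1)) (by simp [supportLabels, gateNode, hs])]
    · exact ActsOn.zero _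
  · split_ifs with hs
    · refine actsOn_diagonal fun x x' h => ?_
      have h : AgreeOn s x x' := h
      have hg : gateNode n s.val = 1 := by
        rw [gateNode, if_pos (by omega)]
        omega
      rw [h.clock_one, h.node (v := 1) (by simp [supportLabels, hg])]
    · exact ActsOn.zero _

theorem basisProj_isHermitian (p : Config (siteDim n T) → Prop) [DecidablePred p] :
    (basisProj p).IsHermitian := by
  rw [basisProj, Matrix.IsHermitian, Matrix.diagonal_conjTranspose]
  congr 1
  funext x
  simp only [Pi.star_apply]
  split_ifs <;> simp

theorem stepTerm_isHermitian (s : Fin T) : (stepTerm s : Op (siteDim n T)).IsHermitian := by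
  unfold stepTerm
  rw [hPropTerm_eq]
  refine (((Matrix.isHermitian_conjTranspose_mul_self _).add (basisProj_isHermitian _)).add
    ?_).add ?_ <;> split_ifs
  · exact basisProj_isHermitian _
  · exact Matrix.isHermitian_zero
  · exact basisProj_isHermitian _
  · exact Matrix.isHermitian_zero

theorem norm_basisProj_le (p : Config (siteDim n T) → Prop) [DecidablePred p] :
    ‖basisProj p‖ ≤ 1 := by
  rw [basisProj, Matrix.l2_opNorm_diagonal]
  refine (pi_norm_le_iff_of_nonneg zero_le_one).2 fun x => ?_
  split_ifs <;> simp

theorem norm_stepOp_le (s : Fin T) : ‖(stepOp s : Op (siteDim n T))‖ ≤ 1 := by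
  have h := Matrix.l2_opNorm_conjTranspose_mul_self (stepOp s : Op (siteDim n T))ᴴ
  rw [Matrix.conjTranspose_conjTranspose, stepOp_mul_conjTranspose,
    Matrix.l2_opNorm_conjTranspose] at h
  have h1 := norm_basisProj_le (n := n) (AfterStep s)
  rw [h] at h1
  nlinarith [norm_nonneg (stepOp s : Op (siteDim n T))]

theorem norm_hPropTerm_le (s : Fin T) : ‖(hPropTerm s : Op (siteDim n T))‖ ≤ 4 := by
  have h : ‖(stepDiff s : Op (siteDim n T))‖ ≤ 2 := by
    refine (norm_sub_le _ _).trans ?_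
    rw [Matrix.l2_opNorm_conjTranspose]
    linarith [norm_stepOp_le (n := n) s, norm_basisProj_le (n := n) (BeforeStep s)]
  rw [hPropTerm_eq, Matrix.l2_opNorm_conjTranspose_mul_self]
  nlinarith [norm_nonneg (stepDiff s : Op (siteDim n T))]

theorem norm_stepTerm_le (s : Fin T) : ‖(stepTerm s : Op (siteDim n T))‖ ≤ 7 := by
  have hite : ∀ (c : Prop) [Decidable c] (p : Config (siteDim n T) → Prop) [DecidablePred p],
      ‖if c then basisProj p else 0‖ ≤ 1 := by
    intro c _ p _
    split_ifs
    · exact norm_basisProj_le p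
    · simp
  unfold stepTerm
  refine (norm_add₄_le).trans ?_
  have h1 := norm_hPropTerm_le (n := n) s
  have h2 := norm_basisProj_le (n := n) (T := T)
    (fun x => clockBit x s.val = 0 ∧ clockBit x (s.val + 1) = 1)
  have h3 := hite (s.val + 1 < n)
    (fun x => nodeState x (n - (s.val + 1)) ≠ 0 ∧ clockBit x (s.val + 1) = 0)
  have h4 := hite (s.val + 2 = n) (fun x => nodeState x 1 ≠ 0 ∧ clockBit x (s.val + 1) = 1)
  linarith

/-- The extra summand `s = 0` vanishes because the formal clock bit at time `0` is `1`. -/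
theorem sum_clock_terms : ∑ s : Fin T,
    basisProj (fun x : Config (siteDim n T) => clockBit x s.val = 0 ∧ clockBit x (s.val + 1) = 1) =
      hClock n T := by
  rw [hClock, Finset.sum_fin_eq_sum_range, Finset.range_eq_Ico]
  rcases Nat.eq_zero_or_pos T with rfl | hT
  · simp
  rw [Finset.sum_eq_sum_Ico_succ_bot hT, dif_pos hT]
  have h0 : basisProj (fun x : Config (siteDim n T) =>
      clockBit x 0 = 0 ∧ clockBit x (0 + 1) = 1) = 0 := by
    rw [basisProj, ← Matrix.diagonal_zero]
    congr 1
  rw [h0, zero_add]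
  refine Finset.sum_congr rfl fun t ht => ?_
  rw [dif_pos (Finset.mem_Ico.1 ht).2]

theorem sum_input_terms (hT : n - 1 ≤ T) : ∑ s : Fin T, (if s.val + 1 < n then
    basisProj (fun x : Config (siteDim n T) =>
      nodeState x (n - (s.val + 1)) ≠ 0 ∧ clockBit x (s.val + 1) = 0) else 0) = hIn n T := by
  let k : ℕ → Op (siteDim n T) := fun v =>
    basisProj (fun x => nodeState x (v + 1) ≠ 0 ∧ clockBit x (n - (v + 1)) = 0)
  have h1 : hIn n T = ∑ v ∈ Finset.range (n - 1), k v := (Finset.sum_range k).symm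
  rw [h1, ← Finset.sum_range_reflect, Finset.sum_range fun j => k (n - 1 - 1 - j)]
  symm
  refine Finset.sum_of_injOn (Fin.castLE hT) (Fin.castLE_injective hT).injOn (by simp) ?_ ?_
  · intro s _ hs
    rw [if_neg]
    intro hlt
    exact hs ⟨⟨s.val, by omega⟩, by simp, rfl⟩
  · intro v _
    have hv := v.2
    simp only [Fin.val_castLE]
    rw [if_pos (by omega)]
    simp only [k]
    rw [show n - 1 - 1 - v.val + 1 = n - (v.val + 1) by omega,
      show n - (n - (v.val + 1)) = v.val + 1 by omega]

theorem sum_output_terms (hn : 2 ≤ n) (hT : n - 1 ≤ T) : ∑ s : Fin T, (if s.val + 2 = n then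
    basisProj (fun x : Config (siteDim n T) =>
      nodeState x 1 ≠ 0 ∧ clockBit x (s.val + 1) = 1) else 0) = hOut n T := by
  rw [Finset.sum_eq_single (⟨n - 2, by omega⟩ : Fin T)]
  · rw [if_pos (by simp only; omega), hOut]
    simp only
    rw [show n - 2 + 1 = n - 1 by omega]
  · intro s _ hs
    rw [if_neg]
    intro h
    exact hs (Fin.ext (by simp only; omega))
  · simp

theorem sum_stepTerm (hn : 2 ≤ n) (hT : n - 1 ≤ T) (J : ℝ) :
    ∑ s : Fin T, (J : ℂ) • stepTerm s = treeCircuitHamiltonian n T J J J J := by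
  rw [← Finset.smul_sum]
  simp only [stepTerm, Finset.sum_add_distrib]
  rw [sum_clock_terms, sum_input_terms hT, sum_output_terms hn hT, treeCircuitHamiltonian]
  change (J : ℂ) • (hProp n T + _ + _ + _) = _
  simp only [smul_add]
  abel

variable (n T) in
/-- The circuit Hamiltonian with equal weights as a local Hamiltonian. -/
noncomputable def treeLocalHamiltonian (J : ℝ) : LocalHamiltonian (siteDim n T) where
  edges := Finset.univ.image (stepSupport n)
  -- Hyperedges form a set, so steps with equal supports are merged into one term. This is why the
  -- norm bound of a term carries a factor `T`.
  term S := ∑ s : Fin T with stepSupport n s = S, (J : ℂ) • stepTerm s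
  hermitian S _ := by
    rw [Matrix.IsHermitian, Matrix.conjTranspose_sum]
    refine Finset.sum_congr rfl fun s _ => ?_
    rw [Matrix.conjTranspose_smul, (stepTerm_isHermitian s).eq, Complex.star_def,
      Complex.conj_ofReal]
  actsOn S _ := by
    refine ActsOn.sum _ fun s hs => ?_
    rw [← (Finset.mem_filter.1 hs).2]
    exact (actsOn_stepTerm s).smul _

theorem treeLocalHamiltonian_total (hn : 2 ≤ n) (hT : n - 1 ≤ T) (J : ℝ) :
    (treeLocalHamiltonian n T J).total = treeCircuitHamiltonian n T J J J J := by
  rw [← sum_stepTerm hn hT]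
  exact Finset.sum_fiberwise_of_maps_to (s := Finset.univ) (g := stepSupport n)
    (fun s hs => Finset.mem_image_of_mem _ hs) fun s : Fin T => (J : ℂ) • stepTerm s

theorem treeLocalHamiltonian_isLocal (J : ℝ) : (treeLocalHamiltonian n T J).IsLocal 6 := by
  intro S hS
  obtain ⟨s, -, rfl⟩ := Finset.mem_image.1 hS
  exact card_stepSupport_le s

theorem treeLocalHamiltonian_degree_le (J : ℝ) (i : Fin n ⊕ (Fin (n - 1) ⊕ Fin T)) :
    (treeLocalHamiltonian n T J).degree i ≤ 6 := by
  unfold LocalHamiltonian.degree treeLocalHamiltonian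
  dsimp only
  rw [Finset.filter_image]
  exact Finset.card_image_le.trans (card_steps_le i)

theorem treeLocalHamiltonian_numTerms_le (J : ℝ) : (treeLocalHamiltonian n T J).numTerms ≤ T := by
  refine Finset.card_image_le.trans ?_
  simp

theorem norm_treeLocalHamiltonian_term_le {J : ℝ} (hJ : 0 ≤ J)
    (S : Finset (Fin n ⊕ (Fin (n - 1) ⊕ Fin T))) :
    ‖(treeLocalHamiltonian n T J).term S‖ ≤ T * (7 * J) := by
  refine (norm_sum_le (E := Op (siteDim n T)) _ _).trans ?_
  have hterm : ∀ s ∈ Finset.univ.filter (fun s : Fin T => stepSupport n s = S),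
      ‖(J : ℂ) • (stepTerm s : Op (siteDim n T))‖ ≤ 7 * J := by
    intro s _
    rw [norm_smul, Complex.norm_real, Real.norm_eq_abs, abs_of_nonneg hJ]
    nlinarith [norm_stepTerm_le (n := n) s]
  refine (Finset.sum_le_card_nsmul _ _ _ hterm).trans ?_
  rw [nsmul_eq_mul]
  refine mul_le_mul_of_nonneg_right ?_ (by positivity)
  have := Finset.card_filter_le (Finset.univ : Finset (Fin T)) (fun s => stepSupport n s = S)
  rw [Finset.card_univ, Fintype.card_fin] at this
  exact_mod_cast this

end Locality

/-! ### The family of simulators -/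

section Family

/-- The number of idle gates. -/
noncomputable def idleLength (ε : ℝ) (n : ℕ) : ℕ := ⌈16 * (n / ε ^ 2)⌉₊

/-- The length of the padded circuit. -/
noncomputable def circuitLength (ε : ℝ) (n : ℕ) : ℕ := 2 * n - 3 + idleLength ε n

/-- The weight of all terms. -/
noncomputable def couplingStrength (ε : ℝ) (n : ℕ) : ℝ := 2 * ((circuitLength ε n : ℝ) + 1) ^ 2

/-- The simulator of `H_A` on `n` qubits. -/
noncomputable def treeSimulator (ε : ℝ) (n : ℕ) : LocalHamiltonian (siteDim n (circuitLength ε n)) :=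
  treeLocalHamiltonian n (circuitLength ε n) (couplingStrength ε n)

variable {ε : ℝ} {n : ℕ}

theorem couplingStrength_pos (ε : ℝ) (n : ℕ) : 0 < couplingStrength ε n := by
  unfold couplingStrength
  positivity

theorem le_div_sq (hε : 0 < ε) (hε1 : ε ≤ 1) (n : ℕ) : (n : ℝ) ≤ n / ε ^ 2 := by
  rw [le_div_iff₀ (by positivity)]
  exact mul_le_of_le_one_right (Nat.cast_nonneg n) (pow_le_one₀ hε.le hε1)

theorem idleLength_le (hε : 0 < ε) (hε1 : ε ≤ 1) (hn : 2 ≤ n) :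
    (idleLength ε n : ℝ) ≤ 17 * (n / ε ^ 2) := by
  -- Rounding up costs at most `1 ≤ n / ε ^ 2`, which raises `16` to `17`.
  have h1 : (idleLength ε n : ℝ) < 16 * (n / ε ^ 2) + 1 := Nat.ceil_lt_add_one (by positivity)
  have h2 := le_div_sq hε hε1 n
  have h3 : (2 : ℝ) ≤ n := by exact_mod_cast hn
  linarith

theorem circuitLength_add_one_le (hε : 0 < ε) (hε1 : ε ≤ 1) (hn : 2 ≤ n) :
    (circuitLength ε n : ℝ) + 1 ≤ 19 * (n / ε ^ 2) := by
  have h1 := idleLength_le hε hε1 hn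
  have h2 := le_div_sq hε hε1 n
  have h3 : circuitLength ε n + 1 ≤ 2 * n + idleLength ε n := by
    unfold circuitLength
    omega
  have h4 : (circuitLength ε n : ℝ) + 1 ≤ 2 * n + idleLength ε n := by exact_mod_cast h3
  linarith

theorem treeSimulator_numTerms_le (hε : 0 < ε) (hε1 : ε ≤ 1) (hn : 2 ≤ n) :
    ((treeSimulator ε n).numTerms : ℝ) ≤ 19 * (n / ε ^ 2) := by
  have h1 : ((treeSimulator ε n).numTerms : ℝ) ≤ circuitLength ε n := by
    exact_mod_cast treeLocalHamiltonian_numTerms_le _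
  linarith [circuitLength_add_one_le hε hε1 hn]

theorem norm_treeSimulator_term_le (hε : 0 < ε) (hε1 : ε ≤ 1) (hn : 2 ≤ n)
    (S : Finset (Fin n ⊕ (Fin (n - 1) ⊕ Fin (circuitLength ε n)))) :
    ‖(treeSimulator ε n).term S‖ ≤ 100000 * (n / ε) ^ 6 := by
  refine (norm_treeLocalHamiltonian_term_le (couplingStrength_pos ε n).le S).trans ?_
  have h1 := circuitLength_add_one_le hε hε1 hn
  have hT : (0 : ℝ) ≤ circuitLength ε n := Nat.cast_nonneg _
  have hn1 : (1 : ℝ) ≤ n := by exact_mod_cast (by omega : 1 ≤ n)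
  have h2 : (n : ℝ) / ε ^ 2 ≤ (n / ε) ^ 2 := by
    rw [div_pow]
    gcongr
    nlinarith
  calc (circuitLength ε n : ℝ) * (7 * couplingStrength ε n)
      ≤ 14 * ((circuitLength ε n : ℝ) + 1) ^ 3 := by
        unfold couplingStrength
        nlinarith [sq_nonneg ((circuitLength ε n : ℝ) + 1)]
    _ ≤ 14 * (19 * (n / ε) ^ 2) ^ 3 := by
        gcongr
        linarith
    -- `14 * 19 ^ 3 = 96026`.
    _ ≤ 100000 * (n / ε) ^ 6 := by
        have : (0 : ℝ) ≤ (n / ε) ^ 6 := by positivity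
        nlinarith

theorem treeSimulator_gapSimulates (hε : 0 < ε) (hn : 2 ≤ n) :
    GapSimulates (HA n).total (treeSimulator ε n).total
      (trivialEncoding (qubitDim n) (workDim n (circuitLength ε n))) ε 0 := by
  have hT : 2 * n - 3 ≤ circuitLength ε n := Nat.le_add_right _ _
  rw [treeSimulator, treeLocalHamiltonian_total hn (by omega)]
  refine treeCircuitHamiltonian_gapSimulates hn hT le_rfl hε.le ?_
  -- The constant `16` is `8 * 2`: there are fewer than `2 n` active gates, and
  -- `norm_projector_sub_le` asks for `8 (1 - ρ) ≤ ε ^ 2`.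
  have h1 : 16 * ((n : ℝ) / ε ^ 2) ≤ idleLength ε n := Nat.le_ceil _
  have h2 : (idleLength ε n : ℝ) ≤ circuitLength ε n := by
    exact_mod_cast Nat.le_add_left _ _
  have h3 : ((2 * n - 3 : ℕ) : ℝ) ≤ 2 * n := by exact_mod_cast Nat.sub_le _ _
  have h4 : ε ^ 2 * (16 * ((n : ℝ) / ε ^ 2)) ≤ ε ^ 2 * (circuitLength ε n + 1) := by
    gcongr
    linarith
  have h5 : ε ^ 2 * (16 * ((n : ℝ) / ε ^ 2)) = 16 * n := by
    field_simp
  linarith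

theorem treeSimulator_isGapSimulator (hε : 0 < ε) (hε1 : ε ≤ 1) :
    IsGapSimulator 2 HA (treeSimulator ε)
      (fun n => trivialEncoding (qubitDim n) (workDim n (circuitLength ε n)))
      6 (fun _ => 6) (fun n => (treeSimulator ε n).numTerms)
      (fun n => 100000 * (n / ε) ^ 6) ε 0 where
  source_local := ⟨2, fun _ _ _ hS => (Finset.mem_powersetCard.1 hS).2.le⟩
  dim_bounded := by
    refine ⟨3, fun n _ => ⟨fun _ => by norm_num [qubitDim], ?_⟩⟩
    rintro (i | v | s)
    · exact (by norm_num : 2 ≤ 3)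
    · exact le_refl 3
    · exact (by norm_num : 2 ≤ 3)
  simulates n hn := treeSimulator_gapSimulates hε hn
  isLocal n _ := treeLocalHamiltonian_isLocal _
  degree_le n _ i := treeLocalHamiltonian_degree_le _ i
  numTerms_eq _ _ := rfl
  strength_le n hn S _ := norm_treeSimulator_term_le hε hε1 hn S

theorem HA_numTerms (n : ℕ) : ((HA n).numTerms : ℝ) = n * (n - 1) / 2 := by
  unfold LocalHamiltonian.numTerms HA
  rw [Finset.card_powersetCard, Finset.card_univ, Fintype.card_fin, Nat.cast_choose_two]

theorem treeSimulator_numTerms_isLittleO (hε : 0 < ε) (hε1 : ε ≤ 1) :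
    (fun n => ((treeSimulator ε n).numTerms : ℝ)) =o[Filter.atTop]
      (fun n => ((HA n).numTerms : ℝ)) := by
  rw [Asymptotics.isLittleO_iff]
  intro c hc
  filter_upwards [Filter.eventually_ge_atTop 2,
    -- The threshold solves `19 n / ε ^ 2 ≤ c n (n - 1) / 2` for `n - 1`.
    Filter.eventually_ge_atTop (⌈38 / ε ^ 2 / c⌉₊ + 1)] with n hn hN
  have h1 := treeSimulator_numTerms_le hε hε1 hn
  have hN' : 38 / ε ^ 2 / c ≤ (n : ℝ) - 1 := by
    have h2 : 38 / ε ^ 2 / c ≤ (⌈38 / ε ^ 2 / c⌉₊ : ℝ) := Nat.le_ceil _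
    have h3 : ((⌈38 / ε ^ 2 / c⌉₊ : ℕ) : ℝ) + 1 ≤ n := by exact_mod_cast hN
    linarith
  have hn1 : (0 : ℝ) ≤ (n : ℝ) - 1 := le_trans (by positivity) hN'
  rw [Real.norm_of_nonneg (Nat.cast_nonneg _), Real.norm_of_nonneg (Nat.cast_nonneg _),
    HA_numTerms]
  refine h1.trans ?_
  rw [div_le_iff₀ hc] at hN'
  have h4 := mul_le_mul_of_nonneg_left hN' (Nat.cast_nonneg (α := ℝ) n)
  calc 19 * ((n : ℝ) / ε ^ 2) = n * (38 / ε ^ 2) / 2 := by ring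
    _ ≤ n * ((n - 1) * c) / 2 := by linarith
    _ = c * (n * (n - 1) / 2) := by ring

end Family

end GapSim

theorem proposition3 :
    ∃ (C : ℝ) (c : ℕ), ∀ ε : ℝ, 0 < ε → ε ≤ 1 →
      ∃ (L M : ℕ → ℕ) (J Jclock Jprop Jin Jout : ℕ → ℝ)
        (H' : ∀ n : ℕ, LocalHamiltonian (siteDim n (2 * n - 3 + L n))),
        (∀ n : ℕ, 2 ≤ n →
          (L n : ℝ) ≤ C * (n / ε ^ 2) ∧
          (M n : ℝ) ≤ C * (n / ε ^ 2) ∧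
          J n ≤ C * (n / ε) ^ c) ∧
        IsDegreeReducer 2 HA H'
          (fun n => trivialEncoding (qubitDim n) (workDim n (2 * n - 3 + L n)))
          6 (fun _ => 6) M J ε 0 ∧
        IsDiluter 2 HA H'
          (fun n => trivialEncoding (qubitDim n) (workDim n (2 * n - 3 + L n)))
          6 (fun _ => 6) M J ε 0 ∧
        (∀ n : ℕ, 2 ≤ n →
          0 < Jclock n ∧ 0 < Jprop n ∧ 0 < Jin n ∧ 0 < Jout n ∧
          (H' n).total = treeCircuitHamiltonian n (2 * n - 3 + L n)
            (Jclock n) (Jprop n) (Jin n) (Jout n)) := by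
  -- The exponent is `6` because a term has norm of order `T * J`, with `J` of order `T ^ 2` and `T`
  -- of order `n / ε ^ 2 ≤ (n / ε) ^ 2`. The constant of the norm bound also covers the factors `17`
  -- and `19` for `L` and `M`.
  refine ⟨100000, 6, fun ε hε hε1 => ⟨idleLength ε, fun n => (treeSimulator ε n).numTerms,
    fun n => 100000 * (n / ε) ^ 6, couplingStrength ε, couplingStrength ε, couplingStrength ε,
    couplingStrength ε, treeSimulator ε, fun n hn => ⟨?_, ?_, le_rfl⟩,
    ⟨treeSimulator_isGapSimulator hε hε1, ?_⟩,
    ⟨treeSimulator_isGapSimulator hε hε1, treeSimulator_numTerms_isLittleO hε hε1⟩,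
    fun n hn => ⟨couplingStrength_pos ε n, couplingStrength_pos ε n, couplingStrength_pos ε n,
      couplingStrength_pos ε n, ?_⟩⟩⟩
  · have h : (0 : ℝ) ≤ n / ε ^ 2 := by positivity
    linarith [idleLength_le hε hε1 hn]
  · have h : (0 : ℝ) ≤ n / ε ^ 2 := by positivity
    linarith [treeSimulator_numTerms_le hε hε1 hn]
  · exact Asymptotics.isBigO_const_const _ one_ne_zero _
  · refine treeLocalHamiltonian_total hn ?_ _
    unfold circuitLength
    omega
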